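/- **Conventions.** Let $\Omega=\{0,1\}^{\mathbb N}$, let $\mathcal E$ be the $\mathbb Q$-linear space of functions $f:\Omega\to\mathbb Q$ that depend on finitely many digits, $\mathcal E^+$ the set of its nonnegative elements, $\mathbf 1\in\mathcal E$ the constant $1$, and $\lambda$ the uniform (fair coin) distribution on $\Omega$, $\lambda(f)=\int f\,d\lambda$. Pairs $(\alpha,\beta)\in\Omega^2$ are encoded in $\Omega$ by interleaving. A *lattice* is a linear subspace $E\subset\mathcal E$ closed under $\min$; for $E\subset\mathcal E$, $\hat E$ is the lattice generated by $E\cup\{\mathbf 1\}$, and $\overline E$ is the set of pointwise suprema of subsets of $E$. A *semimeasure* is a functional $\mu:\mathcal E\to\mathbb R$ with $\mu(-\mathbf 1)\ge-1$, $\mu(f)\ge0$ for $f\in\mathcal E^+$, and $\mu(cf+g)\ge c\mu(f)+\mu(g)$ for $0\le c\in\mathbb Q$; it is *deterministic* if $\mu(\min\{f,g\})=\min\{\mu(f),\mu(g)\}$. It is extended to other functions $g$ by $\mu(g)=\sup\{\mu(h):h\in\mathcal E,\ h\le g\}$. Semimeasures are compared on $\mathcal E^+$. An *operator* $A$ assigns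 to each $\omega\in\Omega$ a semimeasure $A(\omega)$ so that, for every $f\in\mathcal E^+$, the function $A(f):\omega\mapsto A(\omega)(f)$ is in $\overline{\mathcal E}$; it is deterministic if all $A(\omega)$ are. The output distribution is $A(\varphi)(f)=\varphi(A(f))$. *Enumerable* (for semimeasures, and for operators as functions of $(f,\omega)$) means that the subgraph over $f\in\mathcal E^+$ is recursively enumerable (for operators: effectively open in $\omega$). Put $(\mu\otimes\varphi)(h)=\mu\bigl(\alpha\mapsto\varphi(\beta\mapsto h(\alpha,\beta))\bigr)$; $E\otimes\mathcal E$ is the lattice generated by the functions $f(\alpha)g(\beta)$, $f\in E$, $g\in\mathcal E$; and $A(E)=\{f\in\mathcal E^+:A(f)\in\overline E\}$. An $E$-*measure* is a semimeasure that is linear on $\hat E$. For a semimeasure $\varphi$, $\varphi_E$ denotes an $E$-measure $\le\varphi$ whose values on $\hat E\cap\mathcal E^+$ are the largest among all $E$-measures $\le\varphi$ (one exists). Let $\mathbf m$ be a universal distribution on finite binary strings, that is, an enumerable $\mathbf m\ge0$ with $\sum_x\mathbf m(x)\le1$ which is largest among such functions up to constant factors, and let $\mathbf T_\lambda(\omega)=\sum_i\mathbf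 m(\omega_{[i]})\,2^{i}$, where $\omega_{[i]}$ is the $i$-bit prefix of $\omega$. For an operator $A$ let $t_E^A=\sup\{f\in E\cap\mathcal E^+:A(f)\le\mathbf T_\lambda\}$. For an enumerable semimeasure $\mu$, $U_\mu$ denotes a universal one among the deterministic enumerable operators $A$ with $A(\lambda)\le\mu$: for each such $A$, $t_E^{U_\mu}\le C\,t_E^A$, where $C$ does not depend on the set $E\subset\mathcal E$ (closed under nonnegative rational multiples). Let $$\mathbf T_E(\varphi|\mu)=\varphi_E\bigl(t_E^{U_\mu}\bigr),\qquad \mathbf d_E(\varphi|\mu)=\bigl|\lceil\log_2 n\rceil-1\bigr|-2,\quad n=\max\{1,\lceil\mathbf T_E(\varphi|\mu)\rceil\},$$ with $\mathbf d_E(\varphi|\mu)=\infty$ if $\mathbf T_E(\varphi|\mu)=\infty$. **Theorem.** Let $\mu$ be an enumerable semimeasure. (1) There is a constant $c$ such that for all semimeasures $\varphi$ and all lattices $E\subset\mathcal E$, $$\mathbf d_{E\otimes\mathcal E}(\varphi\otimes\lambda\,|\,\mu\otimes\lambda)\le\mathbf d_E(\varphi|\mu)+c.$$ (2) For every deterministic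 enumerable operator $A$ there is a constant $c$ such that for all semimeasures $\varphi$, all lattices $E\subset\mathcal E$ and every choice of $\varphi_E$, $$\mathbf d_{A(E)}(A(\varphi_E)\,|\,A(\mu))\le\mathbf d_E(\varphi|\mu)+c.$$ The constants depend only on $\mu$, on $A$ in (2), and on the choice of $\mathbf m$ and of the universal operators. -/

import Mathlib

open MeasureTheory

namespace Rarity

/-! ### Binary sequences and elementary functions -/

/-- Infinite binary sequences. -/
abbrev W : Type := ℕ → Bool

/-- The `n`-bit prefix of `ω`. -/
def prefixOf (ω : W) (n : ℕ) : List Bool := (List.range n).map ω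

/-- The space of elementary functions: rational functions of finitely many digits. -/
def elementary : Submodule ℚ (W → ℚ) where
  carrier := {f | ∃ n : ℕ, ∀ α β : W, (∀ i < n, α i = β i) → f α = f β}
  zero_mem' := ⟨0, fun _ _ _ => rfl⟩
  add_mem' := by
    rintro f g ⟨n, hn⟩ ⟨k, hk⟩
    refine ⟨max n k, fun α β h => ?_⟩
    simp only [Pi.add_apply]
    rw [hn α β fun i hi => h i (lt_of_lt_of_le hi (le_max_left _ _)),
      hk α β fun i hi => h i (lt_of_lt_of_le hi (le_max_right _ _))]
  smul_mem' := by
    rintro c f ⟨n, hn⟩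
    exact ⟨n, fun α β h => by simp only [Pi.smul_apply]; rw [hn α β h]⟩

/-- Elementary functions, ordered pointwise. -/
abbrev Elem : Type := elementary

/-- The elementary function with constant value `c`. -/
def constElem (c : ℚ) : Elem := ⟨fun _ => c, 0, fun _ _ _ => rfl⟩

/-- The unity. -/
def unity : Elem := constElem 1

/-- The pointwise minimum of elementary functions. -/
def emin (f g : Elem) : Elem :=
  ⟨fun ω => min (f.1 ω) (g.1 ω), by
    obtain ⟨n, hn⟩ := f.2
    obtain ⟨k, hk⟩ := g.2
    refine ⟨max n k, fun α β h => ?_⟩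
    have h1 := hn α β fun i hi => h i (lt_of_lt_of_le hi (le_max_left _ _))
    have h2 := hk α β fun i hi => h i (lt_of_lt_of_le hi (le_max_right _ _))
    simp only [h1, h2]⟩

/-- The (linear) lattices of elementary functions: linear subspaces closed under `min`
(hence under `max`). They need not contain the unity. -/
structure IsLattice (E : Set Elem) : Prop where
  zero_mem : (0 : Elem) ∈ E
  add_mem : ∀ f ∈ E, ∀ g ∈ E, f + g ∈ E
  smul_mem : ∀ (c : ℚ), ∀ f ∈ E, c • f ∈ E
  min_mem : ∀ f ∈ E, ∀ g ∈ E, emin f g ∈ E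

/-- The lattice generated by a set. -/
def latticeSpan (S : Set Elem) : Set Elem := {f | ∀ L : Set Elem, IsLattice L → S ⊆ L → f ∈ L}

/-- The lattice generated by `E` and the unity. -/
def hat (E : Set Elem) : Set Elem := latticeSpan (insert unity E)

/-- `g` is a (pointwise) supremum of a subset of `E`. -/
def IsSupOf (E : Set Elem) (g : W → ℝ) : Prop :=
  ∃ S : Set Elem, S ⊆ E ∧ ∀ ω, IsLUB ((fun f : Elem => (f.1 ω : ℝ)) '' S) (g ω)

/-! ### Semimeasures -/

/-- Semimeasures: normal concave functionals on elementary functions. -/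
structure IsSemimeasure (μ : Elem → ℝ) : Prop where
  normal : -1 ≤ μ (-unity)
  nonneg : ∀ f : Elem, 0 ≤ f → 0 ≤ μ f
  concave : ∀ (c : ℚ) (f g : Elem), 0 ≤ c → c * μ f + μ g ≤ μ (c • f + g)

/-- Deterministic functionals. -/
def IsDeterministic (μ : Elem → ℝ) : Prop := ∀ f g : Elem, μ (emin f g) = min (μ f) (μ g)

/-- Semimeasures are compared on nonnegative elementary functions. -/
def PosLE (μ ν : Elem → ℝ) : Prop := ∀ f : Elem, 0 ≤ f → μ f ≤ ν f

/-- The extension of a functional beyond elementary functions, as for inner measures. -/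
noncomputable def innerExt (φ : Elem → ℝ) (g : W → EReal) : EReal :=
  ⨆ (h : Elem) (_ : ∀ ω, ((h.1 ω : ℝ) : EReal) ≤ g ω), (φ h : EReal)

/-- `E`-measures: semimeasures that are linear on `hat E`. -/
structure IsEMeasure (E : Set Elem) (ν : Elem → ℝ) : Prop where
  semimeasure : IsSemimeasure ν
  linear : ∀ (c : ℚ), ∀ f ∈ hat E, ∀ g ∈ hat E, ν (c • f + g) = c * ν f + ν g

/-- `ψ` is a coarse graining `φ_E` of `φ`: an `E`-measure below `φ` which, on the nonnegative
functions of `hat E`, is the largest one. (There it is unique; it exists, see `exists_coarse`.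
A largest one on all nonnegative elementary functions, when there is one, is included.) -/
structure IsCoarse (E : Set Elem) (φ ψ : Elem → ℝ) : Prop where
  eMeasure : IsEMeasure E ψ
  le : PosLE ψ φ
  largest : ∀ ν, IsEMeasure E ν → PosLE ν φ → ∀ f ∈ hat E, 0 ≤ f → ν f ≤ ψ f

/-- A choice of the coarse graining `φ_E`. -/
noncomputable def coarse (E : Set Elem) (φ : Elem → ℝ) : Elem → ℝ :=
  Classical.epsilon (IsCoarse E φ)

/-- The fair coin measure on `W`. -/
noncomputable def coin : Measure W :=
  Measure.infinitePi fun _ : ℕ => (PMF.uniformOfFintype Bool).toMeasure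

/-- The uniform distribution as a functional. -/
noncomputable def lam (f : Elem) : ℝ := ∫ ω, (f.1 ω : ℝ) ∂coin

/-! ### Pairs -/

/-- The code in `W` of a pair in `W × W`, by interleaving. -/
def pair (α β : W) : W := fun n => if n % 2 = 0 then α (n / 2) else β (n / 2)

/-- The function `β ↦ h (α, β)`. -/
def slice (h : Elem) (α : W) : Elem :=
  ⟨fun β => h.1 (pair α β), by
    obtain ⟨n, hn⟩ := h.2
    refine ⟨n, fun β γ hβ => hn _ _ fun i hi => ?_⟩
    unfold pair
    rw [hβ (i / 2) (lt_of_le_of_lt (Nat.div_le_self i 2) hi)]⟩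

/-- The product of semimeasures: `h ↦ μ (α ↦ ψ (β ↦ h (α, β)))`. -/
noncomputable def prodS (μ ψ : Elem → ℝ) (h : Elem) : ℝ :=
  (innerExt μ fun α => ((ψ (slice h α) : ℝ) : EReal)).toReal

/-- The lattice generated by the products `f (α) * g (β)` with `f` in `E` and `g` elementary. -/
def tensor (E : Set Elem) : Set Elem :=
  latticeSpan {h | ∃ f ∈ E, ∃ g : Elem, ∀ α β, h.1 (pair α β) = f.1 α * g.1 β}

/-! ### Operators -/

/-- Normal concave operators. They take each point `ω` to a semimeasure `A ω`, and nonnegative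
elementary functions `f` to the functions `ω ↦ A ω f`, which are suprema of elementary ones. -/
structure IsOperator (A : W → Elem → ℝ) : Prop where
  semimeasure : ∀ ω, IsSemimeasure (A ω)
  isSup : ∀ f : Elem, 0 ≤ f → IsSupOf Set.univ fun ω => A ω f

/-- The output distribution `A(φ)`, which is `f ↦ φ (A (f))`. -/
noncomputable def output (A : W → Elem → ℝ) (φ : Elem → ℝ) (f : Elem) : ℝ :=
  (innerExt φ fun ω => ((A ω f : ℝ) : EReal)).toReal

/-- `A(E)`: the nonnegative elementary functions that `A` takes to suprema of subsets of `E`. -/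
def imageOf (A : W → Elem → ℝ) (E : Set Elem) : Set Elem :=
  {f | 0 ≤ f ∧ IsSupOf E fun ω => A ω f}

/-! ### Enumerability -/

/-- Codes of rationals. -/
abbrev RatCode : Type := ℕ × ℕ × ℕ

/-- The rational with a given code. -/
def RatCode.val (q : RatCode) : ℚ := ((q.1 : ℚ) - q.2.1) / (q.2.2 + 1)

/-- Codes of elementary functions: rational combinations of indicators of cylinders. -/
abbrev ElemCode : Type := List (List Bool × RatCode)

/-- The indicator of the set of extensions of `x`. -/
def cylinder (x : List Bool) : Elem :=
  ⟨fun ω => if prefixOf ω x.length = x then 1 else 0, by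
    refine ⟨x.length, fun α β h => ?_⟩
    have : prefixOf α x.length = prefixOf β x.length :=
      List.map_congr_left fun i hi => h i (List.mem_range.1 hi)
    simp only [this]⟩

/-- The elementary function with a given code. -/
def ElemCode.val (l : ElemCode) : Elem := (l.map fun p => p.2.val • cylinder p.1).sum

/-- Enumerable functionals: the subgraph over nonnegative elementary functions is
recursively enumerable. -/
def IsEnumerable (μ : Elem → ℝ) : Prop :=
  REPred fun p : ElemCode × RatCode => 0 ≤ p.1.val ∧ (p.2.val : ℝ) < μ p.1.val

/-- Enumerable operators: the subgraph of `(f, ω) ↦ A(f)(ω)` over nonnegative elementary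
functions is recursively enumerable, as a union of basic open sets. -/
def IsEnumerableOp (A : W → Elem → ℝ) : Prop :=
  ∃ R : ElemCode × List Bool × RatCode → Prop, REPred R ∧
    ∀ l : ElemCode, 0 ≤ l.val → ∀ (q : RatCode) (ω : W),
      (q.val : ℝ) < A ω l.val ↔ ∃ n, R (l, prefixOf ω n, q)

/-- Enumerable distributions on strings, of total mass at most `1`. -/
structure IsEnumDistr (m : List Bool → ℝ) : Prop where
  nonneg : ∀ x, 0 ≤ m x
  sum_le : ∀ s : Finset (List Bool), ∑ x ∈ s, m x ≤ 1
  enum : REPred fun p : List Bool × RatCode => (p.2.val : ℝ) < m p.1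

/-- Universal distributions: the largest ones, up to constant factors. -/
def IsUniversalDistr (m : List Bool → ℝ) : Prop :=
  IsEnumDistr m ∧ ∀ m', IsEnumDistr m' → ∃ C : ℝ, ∀ x, m' x ≤ C * m x

/-! ### Tests and rarity -/

/-- The universal test for the uniform distribution: the sum over the prefixes `x` of `ω` of
`m x / 2 ^ (-|x|)`. -/
noncomputable def testLam (m : List Bool → ℝ) (ω : W) : ENNReal :=
  ∑' i : ℕ, ENNReal.ofReal (m (prefixOf ω i) / (2 : ℝ)⁻¹ ^ i)

/-- `t_E^A`: the supremum of the `f ≥ 0` in `E` such that `A(f)` is bounded by the universal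
test. -/
noncomputable def testOf (m : List Bool → ℝ) (A : W → Elem → ℝ) (E : Set Elem) (ω : W) : ENNReal :=
  ⨆ (f : Elem) (_ : f ∈ E ∧ 0 ≤ f ∧ ∀ ξ, ENNReal.ofReal (A ξ f) ≤ testLam m ξ),
    ENNReal.ofReal (f.1 ω : ℝ)

/-- The deterministic normal concave enumerable `A` such that `A(λ) ≤ μ`. -/
structure IsGenerator (μ : Elem → ℝ) (A : W → Elem → ℝ) : Prop where
  operator : IsOperator A
  deterministic : ∀ ω, IsDeterministic (A ω)
  enum : IsEnumerableOp A
  le : PosLE (output A lam) μ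

/-- `U` is a universal generator `U_μ`: one with the smallest tests `t_E^U`, up to constant
factors. (`E` ranges over all sets closed under nonnegative rational multiples, hence over all
lattices and their images under operators; the factor does not depend on `E`.) -/
def IsUniversalGenerator (m : List Bool → ℝ) (μ : Elem → ℝ) (U : W → Elem → ℝ) : Prop :=
  IsGenerator μ U ∧ ∀ A, IsGenerator μ A → ∃ C : NNReal, ∀ E : Set Elem,
    (∀ c : ℚ, 0 ≤ c → ∀ f ∈ E, c • f ∈ E) → ∀ ω, testOf m U E ω ≤ C * testOf m A E ω

/-- `T_E(φ|μ)`, the mean of `t_E^U` under `φ_E`, for `U = U_μ`. -/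
noncomputable def meanTest (m : List Bool → ℝ) (E : Set Elem) (φ : Elem → ℝ) (U : W → Elem → ℝ) :
    ENNReal :=
  (innerExt (coarse E φ) fun ω => (testOf m U E ω : EReal)).toENNReal

/-- `‖a‖ = |⌈log a⌉ - 1|`, with the binary logarithm. -/
noncomputable def size (a : ℝ) : ℤ := |⌈Real.logb 2 a⌉ - 1|

open Classical in
/-- The rarity `d_E(φ|μ) = ‖⌈T⌉‖ - 2` for `T = T_E(φ|μ)`, `U = U_μ`. It is infinite if `T` is; the
value `⌈T⌉ = 0`, which has no logarithm, counts as `1`. -/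
noncomputable def rarity (m : List Bool → ℝ) (E : Set Elem) (φ : Elem → ℝ) (U : W → Elem → ℝ) :
    EReal :=
  if meanTest m E φ U = ⊤ then ⊤
  else (((size (max 1 ⌈(meanTest m E φ U).toReal⌉ : ℤ) - 2 : ℤ) : ℝ) : EReal)

/-! ### Existence of coarse grainings -/

theorem isLattice_latticeSpan (S : Set Elem) : IsLattice (latticeSpan S) where
  zero_mem := fun _ hL _ => hL.zero_mem
  add_mem := fun f hf g hg L hL hS => hL.add_mem f (hf L hL hS) g (hg L hL hS)
  smul_mem := fun c f hf L hL hS => hL.smul_mem c f (hf L hL hS)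
  min_mem := fun f hf g hg L hL hS => hL.min_mem f (hf L hL hS) g (hg L hL hS)

theorem one_mem_hat (E : Set Elem) : unity ∈ hat E := fun _ _ hS => hS (Set.mem_insert _ _)

theorem IsLattice.sub_mem {L : Set Elem} (hL : IsLattice L) {f g : Elem} (hf : f ∈ L)
    (hg : g ∈ L) : f - g ∈ L := by
  have h1 := hL.add_mem f hf _ (hL.smul_mem (-1) g hg)
  have h2 : f + (-1 : ℚ) • g = f - g := Subtype.ext (funext fun ω => by
    change f.1 ω + (-1) * g.1 ω = f.1 ω - g.1 ω
    ring)
  rwa [h2] at h1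

theorem emin_le_left (f g : Elem) : emin f g ≤ f := fun _ => min_le_left _ _

theorem emin_le_right (f g : Elem) : emin f g ≤ g := fun _ => min_le_right _ _

theorem le_emin {f g h : Elem} (h1 : h ≤ f) (h2 : h ≤ g) : h ≤ emin f g :=
  fun ω => le_min (h1 ω) (h2 ω)

theorem sub_nonneg_elem {f g : Elem} (h : f ≤ g) : 0 ≤ g - f := fun ω => sub_nonneg.2 (h ω)

theorem add_nonneg_elem {f g : Elem} (hf : 0 ≤ f) (hg : 0 ≤ g) : 0 ≤ f + g :=
  fun ω => add_nonneg (hf ω) (hg ω)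

theorem smul_nonneg_elem {c : ℚ} (hc : 0 ≤ c) {f : Elem} (hf : 0 ≤ f) : 0 ≤ c • f :=
  fun ω => mul_nonneg hc (hf ω)

theorem IsSemimeasure.super {μ : Elem → ℝ} (hμ : IsSemimeasure μ) (f g : Elem) :
    μ f + μ g ≤ μ (f + g) := by
  have := hμ.concave 1 f g zero_le_one
  simpa using this

theorem IsSemimeasure.map_zero {μ : Elem → ℝ} (hμ : IsSemimeasure μ) : μ 0 = 0 := by
  have h1 := hμ.super 0 0
  have h2 := hμ.nonneg 0 le_rfl
  simp only [add_zero] at h1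
  linarith

theorem IsSemimeasure.mono {μ : Elem → ℝ} (hμ : IsSemimeasure μ) {f g : Elem} (h : f ≤ g) :
    μ f ≤ μ g := by
  have h1 := hμ.super f (g - f)
  have h2 := hμ.nonneg (g - f) (sub_nonneg_elem h)
  rw [add_sub_cancel] at h1
  linarith

theorem IsSemimeasure.map_one_le {μ : Elem → ℝ} (hμ : IsSemimeasure μ) : μ unity ≤ 1 := by
  have h1 := hμ.super unity (-unity)
  rw [add_neg_cancel, hμ.map_zero] at h1
  linarith [hμ.normal]

theorem IsSemimeasure.smul_le {μ : Elem → ℝ} (hμ : IsSemimeasure μ) {c : ℚ} (hc : 0 ≤ c)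
    (f : Elem) : c * μ f ≤ μ (c • f) := by
  have := hμ.concave c f 0 hc
  rwa [hμ.map_zero, add_zero, add_zero] at this

theorem IsSemimeasure.map_smul {μ : Elem → ℝ} (hμ : IsSemimeasure μ) {c : ℚ} (hc : 0 < c)
    (f : Elem) : μ (c • f) = c * μ f := by
  refine le_antisymm ?_ (hμ.smul_le hc.le f)
  have h := hμ.smul_le (inv_nonneg.2 hc.le) (c • f)
  rw [inv_smul_smul₀ hc.ne'] at h
  have hc' : (0 : ℝ) < c := by exact_mod_cast hc
  push_cast at h
  have := mul_le_mul_of_nonneg_left h hc'.le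
  rwa [← mul_assoc, mul_inv_cancel₀ hc'.ne', one_mul] at this

/-- The nonnegative functions of `hat E`. -/
def hatPos (E : Set Elem) : Set Elem := {f | f ∈ hat E ∧ 0 ≤ f}

theorem hatPos_add {E : Set Elem} {a b : Elem} (ha : a ∈ hatPos E) (hb : b ∈ hatPos E) :
    a + b ∈ hatPos E :=
  ⟨(isLattice_latticeSpan _).add_mem _ ha.1 _ hb.1, add_nonneg_elem ha.2 hb.2⟩

theorem hatPos_smul {E : Set Elem} {c : ℚ} (hc : 0 ≤ c) {a : Elem} (ha : a ∈ hatPos E) :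
    c • a ∈ hatPos E :=
  ⟨(isLattice_latticeSpan _).smul_mem _ _ ha.1, smul_nonneg_elem hc ha.2⟩

theorem hatPos_sub {E : Set Elem} {a b : Elem} (ha : a ∈ hatPos E) (hb : b ∈ hatPos E)
    (h : b ≤ a) : a - b ∈ hatPos E :=
  ⟨(isLattice_latticeSpan _).sub_mem ha.1 hb.1, sub_nonneg_elem h⟩

theorem hatPos_emin {E : Set Elem} {a b : Elem} (ha : a ∈ hatPos E) (hb : b ∈ hatPos E) :
    emin a b ∈ hatPos E :=
  ⟨(isLattice_latticeSpan _).min_mem _ ha.1 _ hb.1, le_emin ha.2 hb.2⟩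

theorem hatPos_zero {E : Set Elem} : (0 : Elem) ∈ hatPos E :=
  ⟨(isLattice_latticeSpan _).zero_mem, le_rfl⟩

theorem hatPos_one {E : Set Elem} : unity ∈ hatPos E :=
  ⟨one_mem_hat E, fun _ => zero_le_one (α := ℚ)⟩

theorem hatPos_sum {E : Set Elem} (l : List Elem) (hl : ∀ x ∈ l, x ∈ hatPos E) :
    l.sum ∈ hatPos E := by
  induction l with
  | nil => simpa using hatPos_zero
  | cons x t ih =>
    rw [List.sum_cons]
    exact hatPos_add (hl x (by simp)) (ih fun y hy => hl y (by simp [hy]))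

/-- Every function of `hat E` is a difference of nonnegative ones. -/
theorem hat_eq_sub {E : Set Elem} {f : Elem} (hf : f ∈ hat E) :
    ∃ a ∈ hatPos E, ∃ b ∈ hatPos E, f = a - b := by
  have hL := isLattice_latticeSpan (insert unity E)
  have hm : emin f 0 ∈ hat E := hL.min_mem _ hf _ hL.zero_mem
  refine ⟨f - emin f 0, ⟨hL.sub_mem hf hm, sub_nonneg_elem (emin_le_left _ _)⟩,
    0 - emin f 0, ⟨hL.sub_mem hL.zero_mem hm, sub_nonneg_elem (emin_le_right _ _)⟩, by abel⟩

/-- Values of `φ` on the finite decompositions of `e` into functions of `hatPos E`. -/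
def partSums (E : Set Elem) (φ : Elem → ℝ) (e : Elem) : Set ℝ :=
  {r | ∃ l : List Elem, (∀ x ∈ l, x ∈ hatPos E) ∧ l.sum = e ∧ (l.map φ).sum = r}

/-- The largest additive minorant of `φ` on `hatPos E`. -/
noncomputable def lower (E : Set Elem) (φ : Elem → ℝ) (e : Elem) : ℝ := sInf (partSums E φ e)

theorem partSums_nonneg {E : Set Elem} {φ : Elem → ℝ} (hφ : IsSemimeasure φ) {e : Elem} {r : ℝ}
    (hr : r ∈ partSums E φ e) : 0 ≤ r := by
  obtain ⟨l, hl, -, rfl⟩ := hr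
  refine List.sum_nonneg fun y hy => ?_
  obtain ⟨x, hx, rfl⟩ := List.mem_map.1 hy
  exact hφ.nonneg x (hl x hx).2

theorem self_mem_partSums {E : Set Elem} (φ : Elem → ℝ) {e : Elem} (he : e ∈ hatPos E) :
    φ e ∈ partSums E φ e := ⟨[e], by simpa using he, by simp, by simp⟩

theorem lower_le_mem {E : Set Elem} {φ : Elem → ℝ} (hφ : IsSemimeasure φ) {e : Elem} {r : ℝ}
    (hr : r ∈ partSums E φ e) : lower E φ e ≤ r :=
  csInf_le ⟨0, fun _ h => partSums_nonneg hφ h⟩ hr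

theorem lower_nonneg {E : Set Elem} {φ : Elem → ℝ} (hφ : IsSemimeasure φ) (e : Elem) :
    0 ≤ lower E φ e := Real.sInf_nonneg fun _ h => partSums_nonneg hφ h

theorem split_list {E : Set Elem} {φ : Elem → ℝ} (hφ : IsSemimeasure φ) (l : List Elem)
    (hl : ∀ x ∈ l, x ∈ hatPos E) : ∀ a ∈ hatPos E, ∀ b ∈ hatPos E, l.sum = a + b →
      ∃ r ∈ partSums E φ a, ∃ s ∈ partSums E φ b, r + s ≤ (l.map φ).sum := by
  induction l with
  | nil =>
    intro a ha b hb h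
    have h0 : a = 0 ∧ b = 0 := by
      have hs : ∀ ω, a.1 ω = 0 ∧ b.1 ω = 0 := fun ω => by
        have h1 : 0 ≤ a.1 ω := ha.2 ω
        have h2 : 0 ≤ b.1 ω := hb.2 ω
        have h3 : (0 : ℚ) = a.1 ω + b.1 ω := congrArg (fun f : Elem => f.1 ω) h
        constructor <;> linarith
      exact ⟨Subtype.ext (funext fun ω => (hs ω).1), Subtype.ext (funext fun ω => (hs ω).2)⟩
    obtain ⟨rfl, rfl⟩ := h0
    exact ⟨0, ⟨[], by simp⟩, 0, ⟨[], by simp⟩, by simp⟩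
  | cons x t ih =>
    intro a ha b hb h
    have hx := hl x (by simp)
    have ht : ∀ y ∈ t, y ∈ hatPos E := fun y hy => hl y (by simp [hy])
    rw [List.sum_cons] at h
    have hm := hatPos_emin hx ha
    have hxm := hatPos_sub hx hm (emin_le_left _ _)
    have ham := hatPos_sub ha hm (emin_le_right _ _)
    have hle : x - emin x a ≤ b := fun ω => by
      have h1 : x.1 ω + t.sum.1 ω = a.1 ω + b.1 ω := congrArg (fun f : Elem => f.1 ω) h
      have h2 : 0 ≤ t.sum.1 ω := (hatPos_sum t ht).2 ω
      have h3 : 0 ≤ b.1 ω := hb.2 ω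
      change x.1 ω - min (x.1 ω) (a.1 ω) ≤ b.1 ω
      rcases min_cases (x.1 ω) (a.1 ω) with h4 | h4 <;> linarith
    have hbm := hatPos_sub hb hxm hle
    obtain ⟨r, ⟨l1, hl1, hs1, rfl⟩, s, ⟨l2, hl2, hs2, rfl⟩, hrs⟩ := ih ht _ ham _ hbm (by
      rw [eq_comm, ← sub_eq_zero] at h ⊢
      rw [← h]; abel)
    refine ⟨_, ⟨emin x a :: l1, ?_, ?_, rfl⟩, _, ⟨(x - emin x a) :: l2, ?_, ?_, rfl⟩, ?_⟩
    · intro y hy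
      rcases List.mem_cons.1 hy with rfl | hy
      exacts [hm, hl1 y hy]
    · rw [List.sum_cons, hs1]; abel
    · intro y hy
      rcases List.mem_cons.1 hy with rfl | hy
      exacts [hxm, hl2 y hy]
    · rw [List.sum_cons, hs2]; abel
    · simp only [List.map_cons, List.sum_cons]
      have := hφ.super (emin x a) (x - emin x a)
      rw [add_sub_cancel] at this
      linarith

theorem lower_add {E : Set Elem} {φ : Elem → ℝ} (hφ : IsSemimeasure φ) {a b : Elem}
    (ha : a ∈ hatPos E) (hb : b ∈ hatPos E) :
    lower E φ (a + b) = lower E φ a + lower E φ b := by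
  apply le_antisymm
  · have key : ∀ r ∈ partSums E φ a, ∀ s ∈ partSums E φ b, lower E φ (a + b) ≤ r + s := by
      rintro r ⟨l1, hl1, hs1, rfl⟩ s ⟨l2, hl2, hs2, rfl⟩
      refine lower_le_mem hφ ⟨l1 ++ l2, ?_, by simp [hs1, hs2], by simp⟩
      intro y hy
      rcases List.mem_append.1 hy with hy | hy
      exacts [hl1 y hy, hl2 y hy]
    have h1 : ∀ s ∈ partSums E φ b, lower E φ (a + b) - s ≤ lower E φ a := fun s hs =>
      le_csInf ⟨_, self_mem_partSums φ ha⟩ fun r hr => by linarith [key r hr s hs]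
    have h2 : lower E φ (a + b) - lower E φ a ≤ lower E φ b :=
      le_csInf ⟨_, self_mem_partSums φ hb⟩ fun s hs => by linarith [h1 s hs]
    linarith
  · refine le_csInf ⟨_, self_mem_partSums φ (hatPos_add ha hb)⟩ ?_
    rintro r ⟨l, hl, hs, rfl⟩
    obtain ⟨r, hr, s, hs, h⟩ := split_list hφ l hl a ha b hb hs
    linarith [lower_le_mem hφ hr, lower_le_mem hφ hs]

theorem lower_smul_le {E : Set Elem} {φ : Elem → ℝ} (hφ : IsSemimeasure φ) {c : ℚ} (hc : 0 < c)
    {a : Elem} (ha : a ∈ hatPos E) : lower E φ (c • a) ≤ c * lower E φ a := by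
  have hc' : (0 : ℝ) < c := by exact_mod_cast hc
  rw [← div_le_iff₀' hc']
  refine le_csInf ⟨_, self_mem_partSums φ ha⟩ ?_
  rintro r ⟨l, hl, rfl, rfl⟩
  rw [div_le_iff₀' hc']
  refine lower_le_mem hφ ⟨l.map (c • ·), ?_, ?_, ?_⟩
  · intro y hy
    obtain ⟨x, hx, rfl⟩ := List.mem_map.1 hy
    exact hatPos_smul hc.le (hl x hx)
  · exact List.smul_sum.symm
  · rw [List.map_map, ← smul_eq_mul, List.smul_sum, List.map_map]
    congr 1
    refine List.map_congr_left fun x _ => ?_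
    simp [hφ.map_smul hc]

theorem lower_smul {E : Set Elem} {φ : Elem → ℝ} (hφ : IsSemimeasure φ) {c : ℚ} (hc : 0 < c)
    {a : Elem} (ha : a ∈ hatPos E) : lower E φ (c • a) = c * lower E φ a := by
  refine le_antisymm (lower_smul_le hφ hc ha) ?_
  have hc' : (0 : ℝ) < c := by exact_mod_cast hc
  have h := lower_smul_le hφ (inv_pos.2 hc) (hatPos_smul hc.le ha)
  rw [inv_smul_smul₀ hc.ne'] at h
  push_cast at h
  have := mul_le_mul_of_nonneg_left h hc'.le
  rwa [← mul_assoc, mul_inv_cancel₀ hc'.ne', one_mul] at this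

theorem lower_mono {E : Set Elem} {φ : Elem → ℝ} (hφ : IsSemimeasure φ) {a b : Elem}
    (ha : a ∈ hatPos E) (hb : b ∈ hatPos E) (h : a ≤ b) : lower E φ a ≤ lower E φ b := by
  have h1 := lower_add hφ ha (hatPos_sub hb ha h)
  rw [add_sub_cancel] at h1
  linarith [lower_nonneg (E := E) hφ (b - a)]

/-- Values of the linear extension of `lower` on the functions of `hat E` below `f`. -/
def lowerSet (E : Set Elem) (φ : Elem → ℝ) (f : Elem) : Set ℝ :=
  {r | ∃ a ∈ hatPos E, ∃ b ∈ hatPos E, a - b ≤ f ∧ lower E φ a - lower E φ b = r}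

/-- The least `E`-measure with values `lower` on `hatPos E`. -/
noncomputable def lowerExt (E : Set Elem) (φ : Elem → ℝ) (f : Elem) : ℝ := sSup (lowerSet E φ f)

theorem exists_bound (f : Elem) : ∃ c : ℚ, 0 < c ∧ ∀ ω, |f.1 ω| ≤ c := by
  obtain ⟨n, hn⟩ := f.2
  have hfin : (Set.range f.1).Finite := by
    refine (Set.finite_range fun x : Fin n → Bool =>
      f.1 fun i => if h : i < n then x ⟨i, h⟩ else false).subset ?_
    rintro _ ⟨ω, rfl⟩
    refine ⟨fun i => ω i, hn _ _ fun i hi => ?_⟩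
    simp [hi]
  obtain ⟨c, hc⟩ := (hfin.image fun x => |x|).bddAbove
  refine ⟨max c 1, lt_max_of_lt_right one_pos, fun ω => le_max_of_le_left (hc ?_)⟩
  exact ⟨_, ⟨ω, rfl⟩, rfl⟩

theorem lowerSet_le {E : Set Elem} {φ : Elem → ℝ} (hφ : IsSemimeasure φ) {f p q : Elem}
    (hp : p ∈ hatPos E) (hq : q ∈ hatPos E) (hf : f ≤ p - q) {r : ℝ} (hr : r ∈ lowerSet E φ f) :
    r ≤ lower E φ p - lower E φ q := by
  obtain ⟨a, ha, b, hb, hab, rfl⟩ := hr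
  have h : a + q ≤ b + p := fun ω => by
    have h1 : a.1 ω - b.1 ω ≤ f.1 ω := hab ω
    have h2 : f.1 ω ≤ p.1 ω - q.1 ω := hf ω
    change a.1 ω + q.1 ω ≤ b.1 ω + p.1 ω
    linarith
  have := lower_mono hφ (hatPos_add ha hq) (hatPos_add hb hp) h
  rw [lower_add hφ ha hq, lower_add hφ hb hp] at this
  linarith

theorem lowerSet_nonempty {E : Set Elem} (φ : Elem → ℝ) (f : Elem) :
    (lowerSet E φ f).Nonempty := by
  obtain ⟨c, hc, h⟩ := exists_bound f
  refine ⟨_, 0, hatPos_zero, c • unity, hatPos_smul hc.le hatPos_one, fun ω => ?_, rfl⟩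
  change (0 : ℚ) - c * 1 ≤ f.1 ω
  linarith [(abs_le.1 (h ω)).1]

theorem lowerSet_bddAbove {E : Set Elem} {φ : Elem → ℝ} (hφ : IsSemimeasure φ) (f : Elem) :
    BddAbove (lowerSet E φ f) := by
  obtain ⟨c, hc, h⟩ := exists_bound f
  refine ⟨_, fun r hr => lowerSet_le hφ (hatPos_smul hc.le hatPos_one) hatPos_zero (fun ω => ?_) hr⟩
  change f.1 ω ≤ c * 1 - (0 : ℚ)
  linarith [(abs_le.1 (h ω)).2]

theorem lowerExt_sub {E : Set Elem} {φ : Elem → ℝ} (hφ : IsSemimeasure φ) {a b : Elem}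
    (ha : a ∈ hatPos E) (hb : b ∈ hatPos E) :
    lowerExt E φ (a - b) = lower E φ a - lower E φ b :=
  le_antisymm (csSup_le (lowerSet_nonempty φ _) fun _ hr => lowerSet_le hφ ha hb le_rfl hr)
    (le_csSup (lowerSet_bddAbove hφ _) ⟨a, ha, b, hb, le_rfl, rfl⟩)

theorem lower_zero {E : Set Elem} {φ : Elem → ℝ} (hφ : IsSemimeasure φ) : lower E φ 0 = 0 := by
  have := lower_add (E := E) hφ hatPos_zero hatPos_zero
  rw [add_zero] at this
  linarith

theorem lowerExt_super {E : Set Elem} {φ : Elem → ℝ} (hφ : IsSemimeasure φ) (f g : Elem) :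
    lowerExt E φ f + lowerExt E φ g ≤ lowerExt E φ (f + g) := by
  have key : ∀ r ∈ lowerSet E φ f, ∀ s ∈ lowerSet E φ g, r + s ≤ lowerExt E φ (f + g) := by
    rintro r ⟨a, ha, b, hb, hab, rfl⟩ s ⟨a', ha', b', hb', hab', rfl⟩
    refine le_csSup (lowerSet_bddAbove hφ _)
      ⟨a + a', hatPos_add ha ha', b + b', hatPos_add hb hb', fun ω => ?_, ?_⟩
    · have h1 : a.1 ω - b.1 ω ≤ f.1 ω := hab ω
      have h2 : a'.1 ω - b'.1 ω ≤ g.1 ω := hab' ω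
      change a.1 ω + a'.1 ω - (b.1 ω + b'.1 ω) ≤ f.1 ω + g.1 ω
      linarith
    · rw [lower_add hφ ha ha', lower_add hφ hb hb']; ring
  have h1 : ∀ s ∈ lowerSet E φ g, lowerExt E φ f ≤ lowerExt E φ (f + g) - s := fun s hs =>
    csSup_le (lowerSet_nonempty φ f) fun r hr => by linarith [key r hr s hs]
  have h2 : lowerExt E φ g ≤ lowerExt E φ (f + g) - lowerExt E φ f :=
    csSup_le (lowerSet_nonempty φ g) fun s hs => by linarith [h1 s hs]
  linarith

theorem lowerExt_smul_le {E : Set Elem} {φ : Elem → ℝ} (hφ : IsSemimeasure φ) {c : ℚ}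
    (hc : 0 < c) (f : Elem) : c * lowerExt E φ f ≤ lowerExt E φ (c • f) := by
  have hc' : (0 : ℝ) < c := by exact_mod_cast hc
  rw [← le_div_iff₀' hc']
  refine csSup_le (lowerSet_nonempty φ f) ?_
  rintro r ⟨a, ha, b, hb, hab, rfl⟩
  rw [le_div_iff₀' hc']
  refine le_csSup (lowerSet_bddAbove hφ _)
    ⟨c • a, hatPos_smul hc.le ha, c • b, hatPos_smul hc.le hb, fun ω => ?_, ?_⟩
  · have h1 : a.1 ω - b.1 ω ≤ f.1 ω := hab ω
    change c * a.1 ω - c * b.1 ω ≤ c * f.1 ω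
    rw [← mul_sub]
    exact mul_le_mul_of_nonneg_left h1 hc.le
  · rw [lower_smul hφ hc ha, lower_smul hφ hc hb]; ring

theorem lowerExt_nonneg {E : Set Elem} {φ : Elem → ℝ} (hφ : IsSemimeasure φ) {f : Elem}
    (hf : 0 ≤ f) : 0 ≤ lowerExt E φ f :=
  le_csSup (lowerSet_bddAbove hφ _) ⟨0, hatPos_zero, 0, hatPos_zero, by simpa using hf, by simp⟩

theorem isSemimeasure_lowerExt {E : Set Elem} {φ : Elem → ℝ} (hφ : IsSemimeasure φ) :
    IsSemimeasure (lowerExt E φ) where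
  normal := by
    have h := lowerExt_sub hφ (E := E) hatPos_zero hatPos_one
    rw [zero_sub, lower_zero hφ] at h
    rw [h]
    linarith [lower_le_mem hφ (self_mem_partSums (E := E) φ hatPos_one), hφ.map_one_le]
  nonneg := fun _ hf => lowerExt_nonneg hφ hf
  concave := fun c f g hc => by
    rcases hc.eq_or_lt with rfl | hc
    · simp
    · linarith [lowerExt_super (E := E) hφ (c • f) g, lowerExt_smul_le (E := E) hφ hc f]

theorem lowerExt_eq {E : Set Elem} {φ : Elem → ℝ} (hφ : IsSemimeasure φ) {a : Elem}
    (ha : a ∈ hatPos E) : lowerExt E φ a = lower E φ a := by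
  have := lowerExt_sub hφ ha (hatPos_zero (E := E))
  rwa [sub_zero, lower_zero hφ, sub_zero] at this

theorem isEMeasure_lowerExt {E : Set Elem} {φ : Elem → ℝ} (hφ : IsSemimeasure φ) :
    IsEMeasure E (lowerExt E φ) where
  semimeasure := isSemimeasure_lowerExt hφ
  linear := by
    have hadd : ∀ f ∈ hat E, ∀ g ∈ hat E,
        lowerExt E φ (f + g) = lowerExt E φ f + lowerExt E φ g := by
      intro f hf g hg
      obtain ⟨a, ha, b, hb, rfl⟩ := hat_eq_sub hf
      obtain ⟨a', ha', b', hb', rfl⟩ := hat_eq_sub hg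
      rw [sub_add_sub_comm, lowerExt_sub hφ (hatPos_add ha ha') (hatPos_add hb hb'),
        lowerExt_sub hφ ha hb, lowerExt_sub hφ ha' hb', lower_add hφ ha ha', lower_add hφ hb hb']
      ring
    have hneg : ∀ f ∈ hat E, lowerExt E φ (-f) = -lowerExt E φ f := by
      intro f hf
      obtain ⟨a, ha, b, hb, rfl⟩ := hat_eq_sub hf
      rw [neg_sub, lowerExt_sub hφ ha hb, lowerExt_sub hφ hb ha, neg_sub]
    intro c f hf g hg
    have hcf := (isLattice_latticeSpan (insert unity E)).smul_mem c f hf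
    rw [hadd _ hcf _ hg]
    congr 1
    rcases lt_trichotomy c 0 with hc | rfl | hc
    · have h1 := (isSemimeasure_lowerExt (E := E) hφ).map_smul (neg_pos.2 hc) f
      have h2 : (-c) • f = -(c • f) := Subtype.ext (funext fun ω => neg_mul c (f.1 ω))
      rw [h2, hneg _ hcf] at h1
      push_cast at h1
      linarith
    · simp [(isSemimeasure_lowerExt (E := E) hφ).map_zero]
    · exact (isSemimeasure_lowerExt hφ).map_smul hc f

/-- Every semimeasure has a coarse graining. -/
theorem exists_coarse (E : Set Elem) {φ : Elem → ℝ} (hφ : IsSemimeasure φ) :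
    ∃ ψ, IsCoarse E φ ψ := by
  refine ⟨lowerExt E φ, isEMeasure_lowerExt hφ, fun f hf => ?_, fun ν hν hle f hf hf0 => ?_⟩
  · refine csSup_le (lowerSet_nonempty φ f) ?_
    rintro r ⟨a, ha, b, hb, hab, rfl⟩
    have hm := hatPos_emin ha hb
    have hd := hatPos_sub ha hm (emin_le_left _ _)
    have h1 := lower_add hφ hm hd
    rw [add_sub_cancel] at h1
    have h2 := lower_mono hφ hm hb (emin_le_right _ _)
    have h3 := lower_le_mem hφ (self_mem_partSums φ hd)
    have h4 : a - emin a b ≤ f := fun ω => by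
      have h5 : a.1 ω - b.1 ω ≤ f.1 ω := hab ω
      have h6 : 0 ≤ f.1 ω := hf ω
      change a.1 ω - min (a.1 ω) (b.1 ω) ≤ f.1 ω
      rcases min_cases (a.1 ω) (b.1 ω) with h7 | h7 <;> linarith
    linarith [hφ.mono h4]
  · rw [lowerExt_eq hφ ⟨hf, hf0⟩]
    refine le_csInf ⟨_, self_mem_partSums φ ⟨hf, hf0⟩⟩ ?_
    rintro r ⟨l, hl, rfl, rfl⟩
    clear hf hf0
    induction l with
    | nil => simp [hν.semimeasure.map_zero]
    | cons x t ih =>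
      have hx := hl x (by simp)
      have ht : ∀ y ∈ t, y ∈ hatPos E := fun y hy => hl y (by simp [hy])
      have h1 := hν.linear 1 x hx.1 _ (hatPos_sum t ht).1
      simp only [one_smul, Rat.cast_one, one_mul] at h1
      simp only [List.sum_cons, List.map_cons]
      rw [h1]
      linarith [hle x hx.2, ih ht]

theorem coarse_spec (E : Set Elem) {φ : Elem → ℝ} (hφ : IsSemimeasure φ) :
    IsCoarse E φ (coarse E φ) := Classical.epsilon_spec (exists_coarse E hφ)

end Rarity

open Rarity

/-!
Both parts compare the test of a universal generator `V` with the test of one concrete generator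
`B`: universality gives `t^V ≤ C t^B` with `C` independent of the lattice, and since rarity is
essentially the logarithm of the mean test (`rarity_le_add`), it remains to bound the mean of `t^B`
by a constant times the mean of `t_E^U`. By compactness (`exists_list_of_le_iSup`) a mean of a test
is governed by the maxima of finite sets of functions defining it (`innerExt_testOf_le`).

*Products.* Here `B (α, β) = U(α) ⊗ δ_β` (`sliceOp`). Let `H` be a finite maximum of functions
defining `t_{E ⊗ 𝓔}^B`, and `G` its average over `β`. A measure on `E ⊗ 𝓔` below `φ ⊗ λ` takes at
`H` a value at most `φ_E(G)` (`le_lower_average`), and `G ≤ C t_E^U` (`average_le_testOf`). For the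
latter, fix a point `γ`. Concavity does not bound `U(α)(G)` from above, but the minimum `e` of
the slices of the given functions, all scaled to the value `G(γ)` at `γ`, satisfies
`U(α)(e) · H(γ, β) / G(γ) ≤ T_λ(α, β)`. Averaging over `β` gives `U(α)(e) ≤ ∫ T_λ(α, β) dβ`, which
is at most `C T_λ(α)` because projecting the universal distribution on strings to the digits of
`α` yields an enumerable distribution (`exists_lintegral_testLam_pair_le`).

*Operators.* Here `B = A ∘ U` (`compOp`). If `f` is one of the functions defining `t_{A(E)}^B`, then
`A(f)` is a supremum of functions defining `t_E^U`, so `A(f) ≤ t_E^U`. The maximum of finitely many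
such `f` is a sum of functions `g_j` of the lattice with disjoint supports, each below some `f`
(`exists_disjoint_sum`). A deterministic `A(ω)` is nonzero on at most one `g_j`, hence
`∑ A(g_j) ≤ t_E^U` (`sum_le_testOf`), and an `A(E)`-measure `ν` below `A(φ_E)` takes at the maximum
the value `∑ ν(g_j) ≤ ∑ φ_E(A(g_j)) ≤ φ_E(t_E^U)`.

That `B` is a generator is mostly a matter of enumerability: recursively enumerable predicates are
closed under conjunction, disjunction, existential and bounded universal quantification, and
elementary functions are handled through primitive recursive operations on their codes.
-/

namespace Rarity

/-! ### Recursively enumerable predicates -/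

section RE

variable {α β : Type*} [Primcodable α] [Primcodable β]

theorem _root_.REPred.of_stages {r : α → ℕ → Bool} (hr : Primrec₂ r) :
    REPred fun a => ∃ n, r a n = true := by
  have h1 : Partrec fun a => Nat.rfind fun n => Part.some (r a n) :=
    Partrec.rfind (p := fun a n => Part.some (r a n)) hr.to_comp.partrec
  refine h1.dom_re.of_eq fun a => Nat.rfind_dom.trans ?_
  simp

/-- A predicate is recursively enumerable iff it is the union of an increasing sequence of
primitive recursive stages. -/
theorem rePred_iff_stages {p : α → Prop} : REPred p ↔ ∃ r : α → ℕ → Prop, PrimrecRel r ∧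
    (∀ a n k, n ≤ k → r a n → r a k) ∧ ∀ a, p a ↔ ∃ n, r a n := by
  constructor
  · intro hp
    obtain ⟨c, hc⟩ := Nat.Partrec.Code.exists_code.1 hp
    refine ⟨fun a k => (Nat.Partrec.Code.evaln k c (Encodable.encode a)).isSome = true, ?_, ?_, ?_⟩
    · refine Primrec.primrecPred ?_
      have h : Primrec fun x : α × ℕ =>
          (Nat.Partrec.Code.evaln x.2 c (Encodable.encode x.1)).isSome :=
        Primrec.option_isSome.comp (Nat.Partrec.Code.primrec_evaln.comp
          (Primrec.pair (Primrec.pair Primrec.snd (Primrec.const c))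
            (Primrec.encode.comp Primrec.fst)))
      simpa using h
    · intro a n k hnk h
      obtain ⟨x, hx⟩ := Option.isSome_iff_exists.1 h
      exact Option.isSome_iff_exists.2 ⟨x, Nat.Partrec.Code.evaln_mono hnk hx⟩
    · intro a
      have h1 : p a ↔ (Nat.Partrec.Code.eval c (Encodable.encode a)).Dom := by
        rw [hc]; simp [Part.assert]
      rw [h1, Part.dom_iff_mem]
      simp only [Nat.Partrec.Code.evaln_complete, Option.isSome_iff_exists]
      exact ⟨fun ⟨y, k, h⟩ => ⟨k, y, h⟩, fun ⟨k, y, h⟩ => ⟨y, k, h⟩⟩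
  · classical
    rintro ⟨r, hr, -, h⟩
    exact (REPred.of_stages (r := fun a n => decide (r a n)) hr.decide).of_eq fun a => by
      simp [h]

theorem _root_.REPred.of_primrec {p : α → Prop} (hp : PrimrecPred p) : REPred p :=
  hp.computablePred.to_re

theorem _root_.REPred.comp {p : β → Prop} (hp : REPred p) {f : α → β} (hf : Primrec f) :
    REPred fun a => p (f a) :=
  Partrec.comp hp hf.to_comp

theorem _root_.REPred.and {p q : α → Prop} (hp : REPred p) (hq : REPred q) :
    REPred fun a => p a ∧ q a := by
  obtain ⟨r, hr, mr, hr'⟩ := rePred_iff_stages.1 hp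
  obtain ⟨s, hs, ms, hs'⟩ := rePred_iff_stages.1 hq
  refine rePred_iff_stages.2 ⟨fun a n => r a n ∧ s a n, PrimrecPred.and hr hs,
    fun a n k h h1 => ⟨mr a n k h h1.1, ms a n k h h1.2⟩, fun a => ?_⟩
  rw [hr', hs']
  exact ⟨fun ⟨⟨i, hi⟩, ⟨j, hj⟩⟩ => ⟨max i j, mr a i _ (le_max_left _ _) hi,
    ms a j _ (le_max_right _ _) hj⟩, fun ⟨n, h⟩ => ⟨⟨n, h.1⟩, ⟨n, h.2⟩⟩⟩

theorem _root_.REPred.or {p q : α → Prop} (hp : REPred p) (hq : REPred q) :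
    REPred fun a => p a ∨ q a := by
  obtain ⟨r, hr, mr, hr'⟩ := rePred_iff_stages.1 hp
  obtain ⟨s, hs, ms, hs'⟩ := rePred_iff_stages.1 hq
  refine rePred_iff_stages.2 ⟨fun a n => r a n ∨ s a n, PrimrecPred.or hr hs,
    fun a n k h h1 => h1.imp (mr a n k h) (ms a n k h), fun a => ?_⟩
  rw [hr', hs', exists_or]

theorem _root_.REPred.exists {p : α × β → Prop} (hp : REPred p) :
    REPred fun a => ∃ b, p (a, b) := by
  classical
  obtain ⟨r, hr, -, hr'⟩ := rePred_iff_stages.1 hp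
  have h1 : Primrec₂ fun (a : α) (n : ℕ) => (Option.casesOn (motive := fun _ => Bool)
      (Encodable.decode (α := β) n.unpair.1) false fun b => decide (r (a, b) n.unpair.2)) := by
    have h2 : Primrec fun x : (α × ℕ) × β => x.1.2.unpair.2 :=
      Primrec.snd.comp (Primrec.unpair.comp (Primrec.snd.comp Primrec.fst))
    have h3 : Primrec fun x : α × ℕ => Encodable.decode (α := β) x.2.unpair.1 :=
      Primrec.decode.comp (Primrec.fst.comp (Primrec.unpair.comp Primrec.snd))
    exact Primrec.option_casesOn h3 (Primrec.const _) (hr.decide.comp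
      (Primrec.pair (Primrec.fst.comp Primrec.fst) Primrec.snd) h2)
  refine (REPred.of_stages h1).of_eq fun a => ?_
  constructor
  · rintro ⟨n, hn⟩
    cases hb : (Encodable.decode (α := β) n.unpair.1) with
    | none => simp [hb] at hn
    | some b =>
      rw [hb] at hn
      exact ⟨b, (hr' _).2 ⟨n.unpair.2, by simpa using hn⟩⟩
  · rintro ⟨b, hb⟩
    obtain ⟨n, hn⟩ := (hr' _).1 hb
    exact ⟨Nat.pair (Encodable.encode b) n, by simpa using hn⟩

theorem _root_.REPred.forall_mem {p : β × α → Prop} (hp : REPred p) {f : α → List β}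
    (hf : Primrec f) :
    REPred fun a => ∀ b ∈ f a, p (b, a) := by
  obtain ⟨r, hr, mr, hr'⟩ := rePred_iff_stages.1 hp
  have h1 : PrimrecRel fun (b : β) (x : α × ℕ) => r (b, x.1) x.2 :=
    PrimrecRel.comp hr (Primrec.pair Primrec.fst (Primrec.fst.comp Primrec.snd))
      (Primrec.snd.comp Primrec.snd)
  refine rePred_iff_stages.2 ⟨fun a n => ∀ b ∈ f a, r (b, a) n,
    h1.forall_mem_list.comp (hf.comp Primrec.fst) Primrec.id,
    fun a n k h h2 b hb => mr _ n k h (h2 b hb), fun a => ?_⟩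
  simp only [hr']
  constructor
  · intro h
    choose! g hg using h
    refine ⟨((f a).map g).foldr max 0, fun b hb => mr _ _ _ ?_ (hg b hb)⟩
    exact List.le_max_of_le' 0 (List.mem_map_of_mem hb) le_rfl
  · rintro ⟨n, hn⟩ b hb
    exact ⟨n, hn b hb⟩

end RE

/-! ### Prefixes and elementary functions -/

/-- The sequence that continues a string with zeros. -/
def pad (x : List Bool) : W := fun i => x.getD i false

@[simp] theorem length_prefixOf (ω : W) (n : ℕ) : (prefixOf ω n).length = n := by
  simp [prefixOf]

theorem prefixOf_eq_iff {α β : W} {n : ℕ} :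
    prefixOf α n = prefixOf β n ↔ ∀ i < n, α i = β i := by
  simp [prefixOf]

theorem prefixOf_eq_iff_getD {ω : W} {x : List Bool} :
    prefixOf ω x.length = x ↔ ∀ i < x.length, ω i = x.getD i false := by
  constructor
  · intro h i hi
    rw [← h]
    simp [prefixOf, hi]
  · intro h
    refine List.ext_getElem (by simp) fun i h1 h2 => ?_
    have := h i h2
    simp only [List.getD_eq_getElem _ _ h2] at this
    simp [prefixOf, this]

theorem prefixOf_pad (x : List Bool) : prefixOf (pad x) x.length = x :=
  prefixOf_eq_iff_getD.2 fun _ _ => rfl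

theorem take_prefixOf (ω : W) (j n : ℕ) : (prefixOf ω n).take j = prefixOf ω (min j n) := by
  simp [prefixOf, ← List.map_take, List.take_range]

theorem prefixOf_mono {α β : W} {n k : ℕ} (h : n ≤ k) (hk : prefixOf α k = prefixOf β k) :
    prefixOf α n = prefixOf β n :=
  prefixOf_eq_iff.2 fun i hi => prefixOf_eq_iff.1 hk i (hi.trans_le h)

/-- `f` is a function of the first `n` digits. -/
def HasModulus (f : Elem) (n : ℕ) : Prop := ∀ α β, prefixOf α n = prefixOf β n → f.1 α = f.1 β

theorem exists_hasModulus (f : Elem) : ∃ n, HasModulus f n := by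
  obtain ⟨n, hn⟩ := f.2
  exact ⟨n, fun α β h => hn α β (prefixOf_eq_iff.1 h)⟩

theorem HasModulus.mono {f : Elem} {n k : ℕ} (h : HasModulus f n) (hk : n ≤ k) :
    HasModulus f k := fun α β h1 => h α β (prefixOf_mono hk h1)

theorem HasModulus.apply_pad {f : Elem} {n : ℕ} (h : HasModulus f n) (ω : W) :
    f.1 (pad (prefixOf ω n)) = f.1 ω :=
  h _ _ (by simpa using prefixOf_pad (prefixOf ω n))

/-- The strings of length `n`. -/
def strings : ℕ → List (List Bool)
  | 0 => [[]]
  | n + 1 => (strings n).flatMap fun x => [x ++ [false], x ++ [true]]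

theorem mem_strings {n : ℕ} {x : List Bool} : x ∈ strings n ↔ x.length = n := by
  induction n generalizing x with
  | zero => simp [strings]
  | succ n ih =>
    simp only [strings, List.mem_flatMap, ih, List.mem_cons, List.not_mem_nil, or_false]
    constructor
    · rintro ⟨y, hy, rfl | rfl⟩ <;> simp [hy]
    · intro h
      rcases List.eq_nil_or_concat x with rfl | ⟨y, b, rfl⟩
      · simp at h
      · refine ⟨y, by simpa using h, ?_⟩
        cases b <;> simp

theorem primrec_strings : Primrec strings := by
  have h : Primrec₂ fun (_ : ℕ) (p : ℕ × List (List Bool)) =>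
      p.2.flatMap fun x => [x ++ [false], x ++ [true]] := by
    refine Primrec.list_flatMap (Primrec.snd.comp Primrec.snd) ?_
    exact Primrec.list_cons.comp (Primrec.list_append.comp Primrec.snd (Primrec.const _))
      (Primrec.list_cons.comp (Primrec.list_append.comp Primrec.snd (Primrec.const _))
        (Primrec.const _))
  refine (Primrec.nat_rec' Primrec.id (Primrec.const [[]]) h).of_eq fun n => ?_
  induction n with
  | zero => rfl
  | succ n ih => simp only [id] at ih ⊢; rw [strings, ← ih]

theorem cylinder_apply (x : List Bool) (ω : W) :
    (cylinder x).1 ω = if prefixOf ω x.length = x then 1 else 0 := rfl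

@[simp] theorem add_apply (f g : Elem) (ω : W) : (f + g).1 ω = f.1 ω + g.1 ω := rfl
@[simp] theorem sub_apply (f g : Elem) (ω : W) : (f - g).1 ω = f.1 ω - g.1 ω := rfl
@[simp] theorem neg_apply (f : Elem) (ω : W) : (-f).1 ω = -f.1 ω := rfl
@[simp] theorem smul_apply (c : ℚ) (f : Elem) (ω : W) : (c • f).1 ω = c * f.1 ω := rfl
@[simp] theorem zero_apply (ω : W) : (0 : Elem).1 ω = 0 := rfl
@[simp] theorem unity_apply (ω : W) : unity.1 ω = 1 := rfl
@[simp] theorem emin_apply (f g : Elem) (ω : W) : (emin f g).1 ω = min (f.1 ω) (g.1 ω) := rfl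
@[simp] theorem slice_apply (h : Elem) (α β : W) : (slice h α).1 β = h.1 (pair α β) := rfl

theorem elem_ext {f g : Elem} (h : ∀ ω, f.1 ω = g.1 ω) : f = g := Subtype.ext (funext h)

@[simp] theorem sum_apply {ι : Type*} (s : Finset ι) (f : ι → Elem) (ω : W) :
    (∑ i ∈ s, f i).1 ω = ∑ i ∈ s, (f i).1 ω := by
  simp [Finset.sum_apply]

theorem list_sum_apply (l : List Elem) (ω : W) :
    l.sum.1 ω = (l.map fun f : Elem => f.1 ω).sum := by
  induction l with
  | nil => rfl
  | cons f t ih => simp [List.sum_cons, ih]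

theorem sum_cylinder (n : ℕ) (F : List Bool → ℚ) (ω : W) :
    ∑ x ∈ (strings n).toFinset, F x * (cylinder x).1 ω = F (prefixOf ω n) := by
  rw [Finset.sum_eq_single (prefixOf ω n)]
  · simp [cylinder_apply]
  · intro x hx hne
    rw [List.mem_toFinset, mem_strings] at hx
    rw [cylinder_apply, hx, if_neg (Ne.symm hne), mul_zero]
  · intro h
    exact absurd (List.mem_toFinset.2 (mem_strings.2 (by simp))) h

theorem HasModulus.eq_sum {f : Elem} {n : ℕ} (h : HasModulus f n) :
    f = ∑ x ∈ (strings n).toFinset, f.1 (pad x) • cylinder x :=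
  elem_ext fun ω => by
    rw [sum_apply]
    simp only [smul_apply]
    rw [sum_cylinder n fun x => f.1 (pad x)]
    exact (h.apply_pad ω).symm

/-! ### Interleaving -/

/-- The digits of even index. -/
def evensW (ω : W) : W := fun i => ω (2 * i)

/-- The digits of odd index. -/
def oddsW (ω : W) : W := fun i => ω (2 * i + 1)

/-- The digits of a string at even places. -/
def evens (y : List Bool) : List Bool :=
  (List.range ((y.length + 1) / 2)).map fun i => y.getD (2 * i) false

/-- The digits of a string at odd places. -/
def odds (y : List Bool) : List Bool :=
  (List.range (y.length / 2)).map fun i => y.getD (2 * i + 1) false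

@[simp] theorem length_evens (y : List Bool) : (evens y).length = (y.length + 1) / 2 := by
  simp [evens]

@[simp] theorem length_odds (y : List Bool) : (odds y).length = y.length / 2 := by
  simp [odds]

@[simp] theorem pair_evens_odds (ω : W) : pair (evensW ω) (oddsW ω) = ω := by
  funext n
  unfold pair evensW oddsW
  split_ifs <;> congr 1 <;> omega

@[simp] theorem evensW_pair (α β : W) : evensW (pair α β) = α := by
  funext n
  simp [pair, evensW]

@[simp] theorem oddsW_pair (α β : W) : oddsW (pair α β) = β := by
  funext n
  have : (2 * n + 1) / 2 = n := by omega
  simp [pair, oddsW, Nat.add_mod, this]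

theorem evens_prefixOf (ω : W) (n : ℕ) :
    evens (prefixOf ω n) = prefixOf (evensW ω) ((n + 1) / 2) := by
  unfold evens
  rw [length_prefixOf]
  refine List.map_congr_left fun i hi => ?_
  have hi := List.mem_range.1 hi
  have h2 : 2 * i < n := by omega
  simp [prefixOf, evensW, h2]

theorem odds_prefixOf (ω : W) (n : ℕ) :
    odds (prefixOf ω n) = prefixOf (oddsW ω) (n / 2) := by
  unfold odds
  rw [length_prefixOf]
  refine List.map_congr_left fun i hi => ?_
  have hi := List.mem_range.1 hi
  have h2 : 2 * i + 1 < n := by omega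
  simp [prefixOf, oddsW, h2]

theorem prefixOf_pair_iff {α β : W} {z : List Bool} :
    prefixOf (pair α β) z.length = z ↔
      prefixOf α (evens z).length = evens z ∧ prefixOf β (odds z).length = odds z := by
  constructor
  · intro h
    have h1 := evens_prefixOf (pair α β) z.length
    have h2 := odds_prefixOf (pair α β) z.length
    rw [h] at h1 h2
    simp only [evensW_pair, oddsW_pair] at h1 h2
    simp only [length_evens, length_odds]
    exact ⟨h1.symm, h2.symm⟩
  · rintro ⟨h1, h2⟩
    rw [prefixOf_eq_iff_getD] at h1 h2 ⊢
    simp only [length_evens, length_odds] at h1 h2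
    intro i hi
    unfold pair
    split_ifs with h
    · have h3 : i / 2 < (z.length + 1) / 2 := by omega
      rw [h1 _ h3]
      have h4 : 2 * (i / 2) = i := by omega
      simp [evens, h3, h4]
    · have h3 : i / 2 < z.length / 2 := by omega
      rw [h2 _ h3]
      have h4 : 2 * (i / 2) + 1 = i := by omega
      simp [odds, h3, h4]

theorem cylinder_pair (z : List Bool) (α β : W) :
    (cylinder z).1 (pair α β) = (cylinder (evens z)).1 α * (cylinder (odds z)).1 β := by
  simp only [cylinder_apply, prefixOf_pair_iff]
  split_ifs <;> simp_all

theorem primrec_evens : Primrec evens := by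
  refine Primrec.list_map (Primrec.list_range.comp (Primrec.nat_div.comp
    (Primrec.succ.comp Primrec.list_length) (Primrec.const 2))) ?_
  exact (Primrec.list_getD false).comp Primrec.fst
    (Primrec.nat_mul.comp (Primrec.const 2) Primrec.snd)

theorem primrec_odds : Primrec odds := by
  refine Primrec.list_map (Primrec.list_range.comp (Primrec.nat_div.comp
    Primrec.list_length (Primrec.const 2))) ?_
  exact (Primrec.list_getD false).comp Primrec.fst
    (Primrec.succ.comp (Primrec.nat_mul.comp (Primrec.const 2) Primrec.snd))

/-! ### Codes of rationals and of elementary functions -/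

/-- Addition of coded rationals. -/
def RatCode.add (q r : RatCode) : RatCode :=
  (q.1 * (r.2.2 + 1) + r.1 * (q.2.2 + 1), q.2.1 * (r.2.2 + 1) + r.2.1 * (q.2.2 + 1),
    q.2.2 * r.2.2 + q.2.2 + r.2.2)

theorem RatCode.val_add (q r : RatCode) : (q.add r).val = q.val + r.val := by
  unfold RatCode.val RatCode.add
  push_cast
  have h1 : (q.2.2 : ℚ) + 1 ≠ 0 := by positivity
  have h2 : (r.2.2 : ℚ) + 1 ≠ 0 := by positivity
  have h3 : (q.2.2 : ℚ) * r.2.2 + q.2.2 + r.2.2 + 1 ≠ 0 := by positivity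
  have h4 : (q.2.2 : ℚ) * r.2.2 + q.2.2 + r.2.2 + 1 = (q.2.2 + 1) * (r.2.2 + 1) := by ring
  rw [h4]
  field_simp
  ring

@[simp] theorem RatCode.val_zero : RatCode.val (0, 0, 0) = 0 := by simp [RatCode.val]

theorem RatCode.exists_val_eq (q : ℚ) : ∃ r : RatCode, r.val = q := by
  refine ⟨(q.num.toNat, (-q.num).toNat, q.den - 1), ?_⟩
  unfold RatCode.val
  have h1 : ((q.den - 1 : ℕ) : ℚ) + 1 = q.den := by
    have := q.den_pos
    rw [Nat.cast_sub (by omega)]; simp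
  have h2 : ((q.num.toNat : ℤ) : ℚ) - ((-q.num).toNat : ℤ) = q.num := by
    rw [← Int.cast_sub, Int.toNat_sub_toNat_neg]
  simp only [Int.cast_natCast] at h2
  rw [h1, h2, Rat.num_div_den]

theorem RatCode.val_le_iff {q r : RatCode} : q.val ≤ r.val ↔
    q.1 * (r.2.2 + 1) + r.2.1 * (q.2.2 + 1) ≤ r.1 * (q.2.2 + 1) + q.2.1 * (r.2.2 + 1) := by
  unfold RatCode.val
  have h1 : (0 : ℚ) < (q.2.2 : ℚ) + 1 := by positivity
  have h2 : (0 : ℚ) < (r.2.2 : ℚ) + 1 := by positivity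
  rw [div_le_div_iff₀ h1 h2, ← Nat.cast_le (α := ℚ)]
  push_cast
  constructor <;> intro h <;> linarith

theorem primrec_ratCode_add : Primrec₂ RatCode.add := by
  have a1 : Primrec fun p : RatCode × RatCode => p.1.1 := Primrec.fst.comp Primrec.fst
  have a2 : Primrec fun p : RatCode × RatCode => p.1.2.1 :=
    Primrec.fst.comp (Primrec.snd.comp Primrec.fst)
  have a3 : Primrec fun p : RatCode × RatCode => p.1.2.2 :=
    Primrec.snd.comp (Primrec.snd.comp Primrec.fst)
  have b1 : Primrec fun p : RatCode × RatCode => p.2.1 := Primrec.fst.comp Primrec.snd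
  have b2 : Primrec fun p : RatCode × RatCode => p.2.2.1 :=
    Primrec.fst.comp (Primrec.snd.comp Primrec.snd)
  have b3 : Primrec fun p : RatCode × RatCode => p.2.2.2 :=
    Primrec.snd.comp (Primrec.snd.comp Primrec.snd)
  exact Primrec.pair
    (Primrec.nat_add.comp (Primrec.nat_mul.comp a1 (Primrec.succ.comp b3))
      (Primrec.nat_mul.comp b1 (Primrec.succ.comp a3)))
    (Primrec.pair (Primrec.nat_add.comp (Primrec.nat_mul.comp a2 (Primrec.succ.comp b3))
      (Primrec.nat_mul.comp b2 (Primrec.succ.comp a3)))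
      (Primrec.nat_add.comp (Primrec.nat_add.comp (Primrec.nat_mul.comp a3 b3) a3) b3))

theorem primrec_ratCode_le : PrimrecRel fun q r : RatCode => q.val ≤ r.val := by
  have a1 : Primrec fun p : RatCode × RatCode => p.1.1 := Primrec.fst.comp Primrec.fst
  have a2 : Primrec fun p : RatCode × RatCode => p.1.2.1 :=
    Primrec.fst.comp (Primrec.snd.comp Primrec.fst)
  have a3 : Primrec fun p : RatCode × RatCode => p.1.2.2 :=
    Primrec.snd.comp (Primrec.snd.comp Primrec.fst)
  have b1 : Primrec fun p : RatCode × RatCode => p.2.1 := Primrec.fst.comp Primrec.snd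
  have b2 : Primrec fun p : RatCode × RatCode => p.2.2.1 :=
    Primrec.fst.comp (Primrec.snd.comp Primrec.snd)
  have b3 : Primrec fun p : RatCode × RatCode => p.2.2.2 :=
    Primrec.snd.comp (Primrec.snd.comp Primrec.snd)
  refine PrimrecPred.of_eq (Primrec.nat_le.comp
    (Primrec.nat_add.comp (Primrec.nat_mul.comp a1 (Primrec.succ.comp b3))
      (Primrec.nat_mul.comp b2 (Primrec.succ.comp a3)))
    (Primrec.nat_add.comp (Primrec.nat_mul.comp b1 (Primrec.succ.comp a3))
      (Primrec.nat_mul.comp a2 (Primrec.succ.comp b3)))) fun p => RatCode.val_le_iff.symm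

/-- The (coded) value of a coded elementary function on the extensions of a long enough string. -/
def ElemCode.eval (l : ElemCode) (x : List Bool) : RatCode :=
  l.foldr (fun p s => if x.take p.1.length = p.1 then p.2.add s else s) (0, 0, 0)

theorem primrec_elemCode_eval : Primrec₂ ElemCode.eval := by
  have hp : Primrec fun a : (ElemCode × List Bool) × (List Bool × RatCode) × RatCode => a.2.1.1 :=
    Primrec.fst.comp (Primrec.fst.comp Primrec.snd)
  have h : Primrec fun a : (ElemCode × List Bool) × (List Bool × RatCode) × RatCode =>
      if a.1.2.take a.2.1.1.length = a.2.1.1 then a.2.1.2.add a.2.2 else a.2.2 :=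
    Primrec.ite (Primrec.eq.comp (Primrec.list_take.comp (Primrec.list_length.comp hp)
      (Primrec.snd.comp Primrec.fst)) hp)
      (primrec_ratCode_add.comp (Primrec.snd.comp (Primrec.fst.comp Primrec.snd))
        (Primrec.snd.comp Primrec.snd)) (Primrec.snd.comp Primrec.snd)
  exact Primrec.list_foldr Primrec.fst (Primrec.const (0, 0, 0)) h.to₂

theorem ElemCode.val_cons (p : List Bool × RatCode) (l : ElemCode) :
    ElemCode.val (p :: l) = p.2.val • cylinder p.1 + ElemCode.val l := by
  simp [ElemCode.val]

theorem ElemCode.val_apply {l : ElemCode} {n : ℕ} (h : ∀ p ∈ l, p.1.length ≤ n) (ω : W) :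
    l.val.1 ω = (l.eval (prefixOf ω n)).val := by
  induction l with
  | nil => simp [ElemCode.val, ElemCode.eval]
  | cons p l ih =>
    have h1 : p.1.length ≤ n := h p (by simp)
    rw [ElemCode.val_cons, add_apply, ih fun q hq => h q (by simp [hq]), smul_apply,
      cylinder_apply]
    simp only [ElemCode.eval, List.foldr_cons, take_prefixOf, min_eq_left h1]
    split_ifs
    · rw [RatCode.val_add, mul_one]
    · simp

theorem ElemCode.hasModulus {l : ElemCode} {n : ℕ} (h : ∀ p ∈ l, p.1.length ≤ n) :
    HasModulus l.val n := fun α β hab => by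
  rw [ElemCode.val_apply h, ElemCode.val_apply h, hab]

theorem ElemCode.exists_val_eq (f : Elem) : ∃ l : ElemCode, l.val = f := by
  obtain ⟨n, hn⟩ := exists_hasModulus f
  choose c hc using RatCode.exists_val_eq
  refine ⟨(strings n).toFinset.toList.map fun x => (x, c (f.1 (pad x))), ?_⟩
  conv_rhs => rw [hn.eq_sum]
  simp [ElemCode.val, Function.comp_def, hc, Finset.sum_map_toList]

theorem primrec_bounded_lengths :
    PrimrecRel fun (l : ElemCode) (n : ℕ) => ∀ p ∈ l, p.1.length ≤ n :=
  PrimrecRel.forall_mem_list (Primrec.nat_le.comp (Primrec.list_length.comp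
    (Primrec.fst.comp Primrec.fst)) Primrec.snd)

/-! ### Compactness of the space of sequences -/

theorem prefix_mem_nhds (ω : W) (n : ℕ) : {ξ : W | prefixOf ξ n = prefixOf ω n} ∈ nhds ω := by
  have h : {ξ : W | prefixOf ξ n = prefixOf ω n} = Set.pi (Set.Iio n) fun i => {ω i} := by
    ext ξ
    simp [prefixOf_eq_iff, Set.mem_pi]
  rw [h]
  exact set_pi_mem_nhds (Set.finite_Iio n) fun i _ => by simp

theorem exists_finset_of_locally {ι : Type*} {P : ι → W → Prop}
    (h : ∀ ω, ∃ i n, ∀ ξ, prefixOf ξ n = prefixOf ω n → P i ξ) :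
    ∃ s : Finset ι, ∀ ξ, ∃ i ∈ s, P i ξ := by
  classical
  choose i n hin using h
  obtain ⟨t, ht⟩ := CompactSpace.elim_nhds_subcover _ fun ω => prefix_mem_nhds ω (n ω)
  refine ⟨t.image i, fun ξ => ?_⟩
  have : ξ ∈ ⋃ x ∈ t, {ξ : W | prefixOf ξ (n x) = prefixOf x (n x)} := by rw [ht]; trivial
  simp only [Set.mem_iUnion, Set.mem_ofPred_eq] at this
  obtain ⟨ω, hω, h1⟩ := this
  exact ⟨i ω, Finset.mem_image_of_mem _ hω, hin ω ξ h1⟩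

/-! ### Semimeasures and their extensions -/

theorem IsSemimeasure.abs_le {φ : Elem → ℝ} (hφ : IsSemimeasure φ) {f : Elem} {c : ℚ}
    (h : ∀ ω, |f.1 ω| ≤ c) : |φ f| ≤ c := by
  have hc : 0 ≤ c := (abs_nonneg _).trans (h fun _ => false)
  have hc' : (0 : ℝ) ≤ c := by exact_mod_cast hc
  rw [_root_.abs_le]
  constructor
  · have h1 : c • (-unity) ≤ f := fun ω => by
      have := (_root_.abs_le.1 (h ω)).1
      change c * (-1) ≤ f.1 ω
      linarith
    have h2 := hφ.smul_le hc (-unity)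
    have h3 := mul_le_mul_of_nonneg_left hφ.normal hc'
    linarith [hφ.mono h1]
  · have h1 : f ≤ c • unity := fun ω => by
      have := (_root_.abs_le.1 (h ω)).2
      change f.1 ω ≤ c * 1
      linarith
    have h2 : φ (c • unity) ≤ c * φ unity := by
      rcases hc.eq_or_lt with rfl | hc
      · simp [hφ.map_zero]
      · exact (hφ.map_smul hc _).le
    have h3 := mul_le_mul_of_nonneg_left hφ.map_one_le hc'
    linarith [hφ.mono h1]

theorem IsSemimeasure.exists_bound {X : Type*} {A : X → Elem → ℝ} (hA : ∀ x, IsSemimeasure (A x))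
    (f : Elem) : ∃ c : ℚ, ∀ x, |A x f| ≤ c := by
  obtain ⟨c, -, hc⟩ := Rarity.exists_bound f
  exact ⟨c, fun x => (hA x).abs_le hc⟩

theorem le_innerExt (φ : Elem → ℝ) {g : W → EReal} {h : Elem}
    (hg : ∀ ω, ((h.1 ω : ℝ) : EReal) ≤ g ω) : (φ h : EReal) ≤ innerExt φ g :=
  le_iSup₂ (f := fun (h : Elem) (_ : ∀ ω, ((h.1 ω : ℝ) : EReal) ≤ g ω) => (φ h : EReal)) h hg

/-- The extension of `φ` to real functions, as a real number. It is meant for bounded functions,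
where the supremum in `innerExt` is finite. -/
noncomputable def inner (φ : Elem → ℝ) (g : W → ℝ) : ℝ :=
  (innerExt φ fun ω => (g ω : EReal)).toReal

/-- Bounded real functions. -/
def IsBdd (g : W → ℝ) : Prop := ∃ c : ℚ, ∀ ω, |g ω| ≤ c

theorem IsBdd.elem (f : Elem) : IsBdd fun ω => (f.1 ω : ℝ) := by
  obtain ⟨c, -, hc⟩ := exists_bound f
  exact ⟨c, fun ω => by
    change |(f.1 ω : ℝ)| ≤ c
    exact_mod_cast hc ω⟩

section Inner

variable {φ : Elem → ℝ} (hφ : IsSemimeasure φ)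
include hφ

theorem innerExt_eq_coe {g : W → ℝ} (hg : IsBdd g) :
    innerExt φ (fun ω => (g ω : EReal)) = inner φ g := by
  obtain ⟨c, hc⟩ := hg
  have hc0 : (0 : ℝ) ≤ c := (abs_nonneg _).trans (hc fun _ => false)
  refine (EReal.coe_toReal ?_ ?_).symm
  · refine ne_top_of_le_ne_top (EReal.coe_ne_top (φ (constElem c))) (iSup₂_le fun h hh => ?_)
    refine EReal.coe_le_coe_iff.2 (hφ.mono fun ω => ?_)
    have h1 := EReal.coe_le_coe_iff.1 (hh ω)
    have h2 := (abs_le.1 (hc ω)).2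
    change h.1 ω ≤ c
    exact_mod_cast h1.trans h2
  · refine ne_bot_of_le_ne_bot (EReal.coe_ne_bot (φ (constElem (-c)))) (le_innerExt φ fun ω => ?_)
    have h2 := (abs_le.1 (hc ω)).1
    refine EReal.coe_le_coe_iff.2 ?_
    simpa [constElem] using h2

theorem le_inner {g : W → ℝ} (hg : IsBdd g) {h : Elem} (hh : ∀ ω, (h.1 ω : ℝ) ≤ g ω) :
    φ h ≤ inner φ g := by
  rw [← EReal.coe_le_coe_iff, ← innerExt_eq_coe hφ hg]
  exact le_innerExt φ fun ω => EReal.coe_le_coe_iff.2 (hh ω)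

theorem inner_le {g : W → ℝ} (hg : IsBdd g) {r : ℝ}
    (h : ∀ f : Elem, (∀ ω, (f.1 ω : ℝ) ≤ g ω) → φ f ≤ r) : inner φ g ≤ r := by
  rw [← EReal.coe_le_coe_iff, ← innerExt_eq_coe hφ hg]
  exact iSup₂_le fun f hf =>
    EReal.coe_le_coe_iff.2 (h f fun ω => EReal.coe_le_coe_iff.1 (hf ω))

theorem exists_of_lt_inner {g : W → ℝ} (hg : IsBdd g) {r : ℝ} (hr : r < inner φ g) :
    ∃ f : Elem, (∀ ω, (f.1 ω : ℝ) ≤ g ω) ∧ r < φ f := by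
  by_contra! h
  exact absurd (inner_le hφ hg h) (not_le.2 hr)

theorem inner_elem (f : Elem) : inner φ (fun ω => (f.1 ω : ℝ)) = φ f :=
  le_antisymm (inner_le hφ (IsBdd.elem f) fun _ h => hφ.mono fun ω => by exact_mod_cast h ω)
    (le_inner hφ (IsBdd.elem f) fun _ => le_rfl)

theorem inner_mono {g g' : W → ℝ} (hg : IsBdd g) (hg' : IsBdd g') (h : ∀ ω, g ω ≤ g' ω) :
    inner φ g ≤ inner φ g' :=
  inner_le hφ hg fun _ hf => le_inner hφ hg' fun ω => (hf ω).trans (h ω)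

theorem inner_concave {g g' g'' : W → ℝ} (hg : IsBdd g) (hg' : IsBdd g') (hg'' : IsBdd g'')
    {c : ℚ} (hc : 0 ≤ c) (h : ∀ ω, c * g ω + g' ω ≤ g'' ω) :
    c * inner φ g + inner φ g' ≤ inner φ g'' := by
  have hc' : (0 : ℝ) ≤ c := by exact_mod_cast hc
  have h1 : ∀ f : Elem, (∀ ω, (f.1 ω : ℝ) ≤ g ω) → c * φ f + inner φ g' ≤ inner φ g'' := by
    intro f hf
    have : inner φ g' ≤ inner φ g'' - c * φ f := inner_le hφ hg' fun f' hf' => by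
      have h2 := le_inner hφ hg'' (h := c • f + f') fun ω => by
        have h3 := mul_le_mul_of_nonneg_left (hf ω) hc'
        have h4 := hf' ω
        push_cast [add_apply, smul_apply]
        linarith [h ω]
      linarith [hφ.concave c f f' hc]
    linarith
  rcases hc'.eq_or_lt with h0 | h0
  · rw [← h0]
    obtain ⟨k, hk⟩ := hg
    have := h1 (constElem (-k)) fun ω => by simpa [constElem] using (abs_le.1 (hk ω)).1
    rw [← h0] at this
    simpa using this
  · have : inner φ g ≤ (inner φ g'' - inner φ g') / c := inner_le hφ hg fun f hf => by
      rw [le_div_iff₀ h0]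
      linarith [h1 f hf]
    rw [le_div_iff₀ h0] at this
    linarith

theorem inner_min (hd : IsDeterministic φ) {g g' : W → ℝ} (hg : IsBdd g) (hg' : IsBdd g')
    (hm : IsBdd fun ω => min (g ω) (g' ω)) :
    inner φ (fun ω => min (g ω) (g' ω)) = min (inner φ g) (inner φ g') := by
  refine le_antisymm (le_min (inner_mono hφ hm hg fun ω => min_le_left _ _)
    (inner_mono hφ hm hg' fun ω => min_le_right _ _)) (le_of_forall_lt fun r hr => ?_)
  obtain ⟨h1, h2⟩ := lt_min_iff.1 hr
  obtain ⟨f, hf, hf'⟩ := exists_of_lt_inner hφ hg h1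
  obtain ⟨k, hk, hk'⟩ := exists_of_lt_inner hφ hg' h2
  refine ((lt_min hf' hk').trans_eq (hd f k).symm).trans_le (le_inner hφ hm fun ω => ?_)
  push_cast [emin_apply]
  exact min_le_min (hf ω) (hk ω)

/-- The composition of a semimeasure with a family of semimeasures is a semimeasure. -/
theorem isSemimeasure_inner {G : W → Elem → ℝ} (hG : ∀ ω, IsSemimeasure (G ω)) :
    IsSemimeasure fun f => inner φ fun ω => G ω f where
  normal := hφ.normal.trans (le_inner hφ (IsSemimeasure.exists_bound hG _) fun ω => by
    simpa using (hG ω).normal)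
  nonneg := fun f hf => by
    rw [← hφ.map_zero]
    exact le_inner hφ (IsSemimeasure.exists_bound hG _) fun ω => by simpa using (hG ω).nonneg f hf
  concave := fun c f g hc => inner_concave hφ (IsSemimeasure.exists_bound hG _)
    (IsSemimeasure.exists_bound hG _) (IsSemimeasure.exists_bound hG _) hc fun ω =>
      (hG ω).concave c f g hc

end Inner

/-! ### The fair coin measure -/

instance : IsProbabilityMeasure coin := by unfold coin; infer_instance

theorem prefix_set_eq_pi (x : List Bool) :
    {ω : W | prefixOf ω x.length = x} =
      Set.pi (Finset.range x.length : Set ℕ) fun i => {x.getD i false} := by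
  ext ω
  simp [prefixOf_eq_iff_getD, Set.mem_pi]

theorem measurableSet_prefix (x : List Bool) : MeasurableSet {ω : W | prefixOf ω x.length = x} := by
  rw [prefix_set_eq_pi]
  exact MeasurableSet.pi (Finset.countable_toSet _) fun _ _ => measurableSet_singleton _

theorem coin_prefix (x : List Bool) :
    coin {ω : W | prefixOf ω x.length = x} = (2 : ENNReal)⁻¹ ^ x.length := by
  rw [prefix_set_eq_pi, coin, Measure.infinitePi_pi _ fun _ _ => measurableSet_singleton _]
  simp

theorem cylinder_eq_indicator (x : List Bool) :
    (fun ω => ((cylinder x).1 ω : ℝ)) =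
      Set.indicator {ω : W | prefixOf ω x.length = x} fun _ => (1 : ℝ) := by
  funext ω
  simp only [cylinder_apply, Set.indicator, Set.mem_ofPred_eq]
  split_ifs <;> simp

theorem integrable_elem (f : Elem) : Integrable (fun ω => (f.1 ω : ℝ)) coin := by
  obtain ⟨n, hn⟩ := exists_hasModulus f
  rw [hn.eq_sum]
  simp only [sum_apply, smul_apply, Rat.cast_sum, Rat.cast_mul]
  refine integrable_finsetSum _ fun x _ => Integrable.const_mul ?_ _
  rw [cylinder_eq_indicator]
  exact (integrable_const _).indicator (measurableSet_prefix x)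

theorem lam_cylinder (x : List Bool) : lam (cylinder x) = (2 : ℝ)⁻¹ ^ x.length := by
  rw [lam, cylinder_eq_indicator, integral_indicator_const _ (measurableSet_prefix x),
    measureReal_def, coin_prefix]
  simp

theorem lam_add (f g : Elem) : lam (f + g) = lam f + lam g := by
  simp only [lam, add_apply, Rat.cast_add]
  exact integral_add (integrable_elem f) (integrable_elem g)

theorem lam_smul (c : ℚ) (f : Elem) : lam (c • f) = c * lam f := by
  simp only [lam, smul_apply, Rat.cast_mul]
  exact integral_const_mul _ _

theorem lam_sum {ι : Type*} (s : Finset ι) (f : ι → Elem) :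
    lam (∑ i ∈ s, f i) = ∑ i ∈ s, lam (f i) := by
  simp only [lam, sum_apply, Rat.cast_sum]
  exact integral_finsetSum _ fun i _ => integrable_elem (f i)

theorem lam_unity : lam unity = 1 := by simp [lam]

theorem isSemimeasure_lam : IsSemimeasure lam where
  normal := by
    have : -unity = (-1 : ℚ) • unity := elem_ext fun ω => by simp
    rw [this, lam_smul, lam_unity]
    simp
  nonneg := fun f hf => integral_nonneg fun ω => Rat.cast_nonneg.2 (hf ω)
  concave := fun c f g _ => by rw [lam_add, lam_smul]

theorem HasModulus.lam_eq {f : Elem} {n : ℕ} (h : HasModulus f n) :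
    lam f = ∑ x ∈ (strings n).toFinset, (2 : ℝ)⁻¹ ^ n * f.1 (pad x) := by
  conv_lhs => rw [h.eq_sum]
  rw [lam_sum]
  refine Finset.sum_congr rfl fun x hx => ?_
  rw [lam_smul, lam_cylinder, mem_strings.1 (List.mem_toFinset.1 hx), mul_comm]

/-! ### Comparison of rarities -/

theorem size_le_add {n n' : ℤ} {C : ℕ} (hn : 1 ≤ n) (hn' : 1 ≤ n') (hC : 1 ≤ C)
    (h : n' ≤ C * n) : size n' ≤ size n + (⌈Real.logb 2 C⌉ + 2) := by
  have h1 : (1 : ℝ) ≤ n := by exact_mod_cast hn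
  have h1' : (1 : ℝ) ≤ n' := by exact_mod_cast hn'
  have hC' : (1 : ℝ) ≤ C := by exact_mod_cast hC
  have h2 : (n' : ℝ) ≤ C * n := by exact_mod_cast h
  have h3 : Real.logb 2 n' ≤ Real.logb 2 C + Real.logb 2 n := by
    rw [← Real.logb_mul (by linarith) (by linarith)]
    exact Real.logb_le_logb_of_le one_lt_two (by linarith) h2
  have h4 : ⌈Real.logb 2 n'⌉ ≤ ⌈Real.logb 2 C⌉ + ⌈Real.logb 2 n⌉ :=
    (Int.ceil_le_ceil h3).trans (Int.ceil_add_le _ _)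
  have h5 : 0 ≤ ⌈Real.logb 2 n'⌉ := Int.ceil_nonneg (Real.logb_nonneg one_lt_two h1')
  have h6 : 0 ≤ ⌈Real.logb 2 C⌉ := Int.ceil_nonneg (Real.logb_nonneg one_lt_two hC')
  have h7 : ⌈Real.logb 2 n⌉ - 1 ≤ |⌈Real.logb 2 n⌉ - 1| := le_abs_self _
  unfold size
  rw [abs_le]
  have h8 : 0 ≤ |⌈Real.logb 2 n⌉ - 1| := abs_nonneg _
  constructor <;> linarith

/-- Rarity is the logarithm of the mean test, so it grows at most by a constant when the mean test
grows by a constant factor. -/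
theorem rarity_le_add (m : List Bool → ℝ) {C : ℕ} (hC : 1 ≤ C) {E E' : Set Elem}
    {φ φ' : Elem → ℝ} {U V : W → Elem → ℝ} (h : meanTest m E' φ' V ≤ C * meanTest m E φ U) :
    rarity m E' φ' V ≤ rarity m E φ U + (((⌈Real.logb 2 C⌉ + 2 : ℤ) : ℝ) : EReal) := by
  unfold rarity
  by_cases ht : meanTest m E φ U = ⊤
  · rw [if_pos ht, EReal.top_add_coe]
    exact le_top
  have ht' : meanTest m E' φ' V ≠ ⊤ :=
    ne_top_of_le_ne_top (ENNReal.mul_ne_top (ENNReal.natCast_ne_top C) ht) h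
  rw [if_neg ht, if_neg ht', ← EReal.coe_add, EReal.coe_le_coe_iff, ← Int.cast_add, Int.cast_le]
  set T := (meanTest m E φ U).toReal
  set T' := (meanTest m E' φ' V).toReal
  have h1 : T' ≤ C * T := by
    have := ENNReal.toReal_mono (ENNReal.mul_ne_top (ENNReal.natCast_ne_top C) ht) h
    simpa using this
  have hC' : (1 : ℤ) ≤ C := by exact_mod_cast hC
  have h2 : max 1 ⌈T'⌉ ≤ (C : ℤ) * max 1 ⌈T⌉ := by
    refine max_le ?_ (Int.ceil_le.2 (h1.trans ?_))
    · exact one_le_mul_of_one_le_of_one_le hC' (le_max_left _ _)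
    · push_cast
      exact mul_le_mul_of_nonneg_left ((Int.le_ceil T).trans (le_max_right _ _)) (Nat.cast_nonneg C)
  have h3 := size_le_add (le_max_left _ _) (le_max_left _ _) hC h2
  push_cast at h3 ⊢
  linarith

/-! ### Images of enumerable distributions on strings -/

theorem primrecPred_nodup {α : Type*} [Primcodable α] :
    PrimrecPred fun l : List α => l.Nodup := by
  classical
  have h : Primrec fun a : List α × (α × List α × Bool) =>
      (!decide (∃ b ∈ a.2.2.1, b = a.2.1)) && a.2.2.2 := by
    have h1 : PrimrecRel fun (l : List α) (a : α) => ∃ b ∈ l, b = a :=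
      PrimrecRel.exists_mem_list Primrec.eq
    exact Primrec.and.comp (Primrec.not.comp (h1.decide.comp (Primrec.fst.comp
      (Primrec.snd.comp Primrec.snd)) (Primrec.fst.comp Primrec.snd)))
      (Primrec.snd.comp (Primrec.snd.comp Primrec.snd))
  refine ⟨inferInstance, ?_⟩
  refine (Primrec.list_rec Primrec.id (Primrec.const true) h.to₂).of_eq fun l => ?_
  simp only [id]
  induction l with
  | nil => simp
  | cons a t ih =>
    have h2 : decide (a :: t).Nodup = (!decide (∃ b ∈ t, b = a) && decide t.Nodup) := by simp
    rw [h2, ← ih]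

theorem IsEnumDistr.summable {m : List Bool → ℝ} (hm : IsEnumDistr m) : Summable m :=
  summable_of_sum_le hm.nonneg hm.sum_le

/-- The image of a distribution on strings under a map. -/
noncomputable def pushDistr (g : List Bool → List Bool) (m : List Bool → ℝ) (x : List Bool) : ℝ :=
  ∑' y, if g y = x then m y else 0

/-- The sum of coded rationals. -/
def ratSum (L : List (List Bool × RatCode)) : RatCode := L.foldr (fun p s => p.2.add s) (0, 0, 0)

theorem primrec_ratSum : Primrec ratSum := by
  have h : Primrec fun a : List (List Bool × RatCode) × (List Bool × RatCode) × RatCode =>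
      a.2.1.2.add a.2.2 := primrec_ratCode_add.comp
    (Primrec.snd.comp (Primrec.fst.comp Primrec.snd)) (Primrec.snd.comp Primrec.snd)
  exact Primrec.list_foldr Primrec.id (Primrec.const (0, 0, 0)) h.to₂

theorem val_ratSum (L : List (List Bool × RatCode)) :
    (ratSum L).val = (L.map fun p => p.2.val).sum := by
  induction L with
  | nil => simp [ratSum]
  | cons p L ih => simp only [ratSum] at ih; simp [ratSum, RatCode.val_add, ih]

/-- A lower bound for the image distribution at `x` is witnessed by lower bounds for finitely many
distinct preimages of `x`. -/
theorem lt_pushDistr_iff {m : List Bool → ℝ} (hm : IsEnumDistr m) (g : List Bool → List Bool)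
    (x : List Bool) (q : RatCode) : (q.val : ℝ) < pushDistr g m x ↔
      ∃ L : List (List Bool × RatCode), (L.map Prod.fst).Nodup ∧
        (∀ p ∈ L, g p.1 = x ∧ (p.2.val : ℝ) < m p.1) ∧ ¬ (ratSum L).val ≤ q.val := by
  have h0 : ∀ y, 0 ≤ if g y = x then m y else 0 := fun y => by
    split_ifs
    exacts [hm.nonneg y, le_rfl]
  have hs : Summable fun y => if g y = x then m y else 0 :=
    Summable.of_nonneg_of_le h0 (fun y => by split_ifs; exacts [le_rfl, hm.nonneg y]) hm.summable
  constructor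
  · intro h
    obtain ⟨s, hs1⟩ := ((hs.hasSum.eventually (lt_mem_nhds h)).exists)
    rw [← Finset.sum_filter] at hs1
    set t := s.filter fun y => g y = x
    -- the slack is distributed evenly among the terms
    set ε := (∑ y ∈ t, m y - q.val) / (t.card + 1) with hε
    have hε0 : 0 < ε := div_pos (by linarith) (by positivity)
    have h1 : ∀ y, ∃ r : RatCode, m y - ε < r.val ∧ (r.val : ℝ) < m y := fun y => by
      obtain ⟨r, hr1, hr2⟩ := exists_rat_btwn (show m y - ε < m y by linarith)
      obtain ⟨c, rfl⟩ := RatCode.exists_val_eq r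
      exact ⟨c, hr1, hr2⟩
    choose c hc1 hc2 using h1
    refine ⟨t.toList.map fun y => (y, c y), ?_, ?_, ?_⟩
    · simpa [Function.comp_def] using t.nodup_toList
    · intro p hp
      obtain ⟨y, hy, rfl⟩ := List.mem_map.1 hp
      exact ⟨(Finset.mem_filter.1 (Finset.mem_toList.1 hy)).2, hc2 y⟩
    · rw [not_le, val_ratSum]
      simp only [List.map_map, Function.comp_def, Finset.sum_map_toList]
      rw [← Rat.cast_lt (K := ℝ)]
      push_cast
      have h2 : ∑ y ∈ t, (m y - ε) ≤ ∑ y ∈ t, ((c y).val : ℝ) :=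
        Finset.sum_le_sum fun y _ => (hc1 y).le
      rw [Finset.sum_sub_distrib, Finset.sum_const, nsmul_eq_mul] at h2
      have h3 : ε * (t.card + 1) = ∑ y ∈ t, m y - q.val := by
        rw [hε]; field_simp
      linarith
  · rintro ⟨L, hL, hp, hq⟩
    rw [not_le, val_ratSum] at hq
    have h1 : (((L.map fun p => p.2.val).sum : ℚ) : ℝ) ≤ ((L.map Prod.fst).map m).sum := by
      clear hL hq
      induction L with
      | nil => simp
      | cons p L ih =>
        simp only [List.map_cons, List.sum_cons, Rat.cast_add]
        exact add_le_add (hp p (by simp)).2.le (ih fun r hr => hp r (by simp [hr]))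
    have h2 : ((L.map Prod.fst).map m).sum = ∑ y ∈ (L.map Prod.fst).toFinset, m y :=
      (List.sum_toFinset m hL).symm
    have h3 : ∑ y ∈ (L.map Prod.fst).toFinset, m y =
        ∑ y ∈ (L.map Prod.fst).toFinset, if g y = x then m y else 0 := by
      refine Finset.sum_congr rfl fun y hy => ?_
      obtain ⟨p, hpL, rfl⟩ := List.mem_map.1 (List.mem_toFinset.1 hy)
      rw [if_pos (hp p hpL).1]
    have h4 := hs.sum_le_tsum (L.map Prod.fst).toFinset fun y _ => h0 y
    have h5 : (q.val : ℝ) < (((L.map fun p => p.2.val).sum : ℚ) : ℝ) := by exact_mod_cast hq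
    unfold pushDistr
    linarith

theorem IsEnumDistr.push {m : List Bool → ℝ} (hm : IsEnumDistr m) {g : List Bool → List Bool}
    (hg : Primrec g) : IsEnumDistr (pushDistr g m) where
  nonneg := fun x => tsum_nonneg fun y => by
    split_ifs
    exacts [hm.nonneg y, le_rfl]
  sum_le := fun s => by
    have hs : ∀ x, Summable fun y => if g y = x then m y else 0 := fun x =>
      Summable.of_nonneg_of_le (fun y => by split_ifs; exacts [hm.nonneg y, le_rfl])
        (fun y => by split_ifs; exacts [le_rfl, hm.nonneg y]) hm.summable
    unfold pushDistr
    rw [← Summable.tsum_finsetSum fun x _ => hs x]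
    refine (Summable.tsum_le_tsum (fun y => ?_) (summable_sum fun x _ => hs x)
      hm.summable).trans (hm.summable.tsum_le_of_sum_le hm.sum_le)
    rw [Finset.sum_ite_eq]
    split_ifs
    exacts [le_rfl, hm.nonneg y]
  enum := by
    have h1 : REPred fun a : (List Bool × RatCode) × ((List Bool × RatCode) ×
        List (List Bool × RatCode)) => g a.1.1 = a.2.1.1 ∧ (a.1.2.val : ℝ) < m a.1.1 :=
      REPred.and (REPred.of_primrec (Primrec.eq.comp (hg.comp (Primrec.fst.comp Primrec.fst))
        (Primrec.fst.comp (Primrec.fst.comp Primrec.snd)))) (hm.enum.comp Primrec.fst)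
    have h2 : REPred fun a : (List Bool × RatCode) × List (List Bool × RatCode) =>
        (a.2.map Prod.fst).Nodup := REPred.of_primrec (primrecPred_nodup.comp
      (Primrec.list_map Primrec.snd (Primrec.fst.comp Primrec.snd).to₂))
    have h3 : REPred fun a : (List Bool × RatCode) × List (List Bool × RatCode) =>
        ¬ (ratSum a.2).val ≤ a.1.2.val := REPred.of_primrec (PrimrecPred.not
      (primrec_ratCode_le.comp (primrec_ratSum.comp Primrec.snd) (Primrec.snd.comp Primrec.fst)))
    exact (h2.and ((h1.forall_mem Primrec.snd).and h3)).exists.of_eq fun a =>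
      (lt_pushDistr_iff hm g a.1 a.2).symm

/-! ### Averages of the universal test -/

theorem tsum_prefix (F : List Bool → ENNReal) (ω : W) :
    ∑' y, (if prefixOf ω y.length = y then F y else 0) = ∑' i, F (prefixOf ω i) := by
  have hinj : Function.Injective (prefixOf ω) := fun i j h => by
    have := congrArg List.length h
    simpa using this
  rw [← hinj.tsum_eq]
  · simp
  · intro y hy
    have : prefixOf ω y.length = y := by
      by_contra h
      simp [h] at hy
    exact ⟨_, this⟩

theorem tsum_fiber {X Y : Type*} (e : Y → X) (F : Y → X → ENNReal) :
    ∑' y, F y (e y) = ∑' x, ∑' y, open Classical in if e y = x then F y x else 0 := by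
  classical
  rw [ENNReal.tsum_comm]
  refine tsum_congr fun y => ?_
  rw [tsum_eq_single (e y)]
  · simp
  · intro x hx
    simp [hx.symm]

theorem testLam_mono {m m' : List Bool → ℝ} {C : ℝ} (hC : 0 ≤ C) (h : ∀ x, m' x ≤ C * m x) (ω : W) :
    testLam m' ω ≤ ENNReal.ofReal C * testLam m ω := by
  unfold testLam
  rw [← ENNReal.tsum_mul_left]
  refine ENNReal.tsum_le_tsum fun i => ?_
  rw [← ENNReal.ofReal_mul hC, mul_div_assoc']
  exact ENNReal.ofReal_le_ofReal (div_le_div_of_nonneg_right (h _) (by positivity))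

theorem measurable_prefix_ite (x : List Bool) (c : ENNReal) :
    Measurable fun ω : W => if prefixOf ω x.length = x then c else 0 :=
  Measurable.ite (measurableSet_prefix x) measurable_const measurable_const

/-- The average over `β` of the test for `λ` at `(α, β)` is the test at `α` for the distribution of
the `α`-part of a random string. -/
theorem lintegral_testLam_pair {m : List Bool → ℝ} (hm : IsEnumDistr m) (α : W) :
    ∫⁻ β, testLam m (pair α β) ∂coin = testLam (pushDistr evens m) α := by
  have h1 : ∀ y : List Bool, ∫⁻ β, (if prefixOf (pair α β) y.length = y then
      ENNReal.ofReal (m y / (2 : ℝ)⁻¹ ^ y.length) else 0) ∂coin =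
      if prefixOf α (evens y).length = evens y then
        ENNReal.ofReal (m y / (2 : ℝ)⁻¹ ^ (evens y).length) else 0 := by
    intro y
    simp only [prefixOf_pair_iff]
    split_ifs with h
    · simp only [h, true_and]
      have h2 : ∀ β : W, (if prefixOf β (odds y).length = odds y then
          ENNReal.ofReal (m y / (2 : ℝ)⁻¹ ^ y.length) else 0) =
          Set.indicator {β : W | prefixOf β (odds y).length = odds y}
            (fun _ => ENNReal.ofReal (m y / (2 : ℝ)⁻¹ ^ y.length)) β := fun β => by
        simp [Set.indicator]
      simp only [h2]
      rw [lintegral_indicator_const (measurableSet_prefix _), coin_prefix]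
      have h3 : (2 : ENNReal)⁻¹ ^ (odds y).length =
          ENNReal.ofReal ((2 : ℝ)⁻¹ ^ (odds y).length) := by
        rw [ENNReal.ofReal_pow (by positivity), ENNReal.ofReal_inv_of_pos two_pos]
        simp
      rw [h3, ← ENNReal.ofReal_mul (div_nonneg (hm.nonneg y) (by positivity))]
      congr 1
      have h4 : y.length = (evens y).length + (odds y).length := by
        simp only [length_evens, length_odds]
        omega
      rw [div_mul_eq_mul_div, h4, pow_add, mul_div_mul_right _ _ (by positivity)]
    · simp only [h, false_and, if_false, lintegral_zero]
  have h2 : ∀ β, testLam m (pair α β) = ∑' y : List Bool, (if prefixOf (pair α β) y.length = y then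
      ENNReal.ofReal (m y / (2 : ℝ)⁻¹ ^ y.length) else 0) := fun β => by
    rw [tsum_prefix fun y => ENNReal.ofReal (m y / (2 : ℝ)⁻¹ ^ y.length)]
    simp [testLam]
  simp only [h2]
  rw [lintegral_tsum]
  · simp only [h1]
    rw [tsum_fiber evens fun y x => if prefixOf α x.length = x then
      ENNReal.ofReal (m y / (2 : ℝ)⁻¹ ^ x.length) else 0]
    have h3 : testLam (pushDistr evens m) α = ∑' x : List Bool, (if prefixOf α x.length = x then
        ENNReal.ofReal (pushDistr evens m x / (2 : ℝ)⁻¹ ^ x.length) else 0) := by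
      rw [tsum_prefix fun x => ENNReal.ofReal (pushDistr evens m x / (2 : ℝ)⁻¹ ^ x.length)]
      simp [testLam]
    rw [h3]
    refine tsum_congr fun x => ?_
    split_ifs with h
    · unfold pushDistr
      rw [← tsum_div_const, ENNReal.ofReal_tsum_of_nonneg]
      · refine tsum_congr fun y => ?_
        split_ifs <;> simp
      · intro y
        split_ifs
        · exact div_nonneg (hm.nonneg y) (by positivity)
        · simp
      · refine Summable.div_const (Summable.of_nonneg_of_le (fun y => ?_) (fun y => ?_)
          hm.summable) _
        · split_ifs
          exacts [hm.nonneg y, le_rfl]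
        · split_ifs
          exacts [le_rfl, hm.nonneg y]
    · simp
  · intro y
    refine Measurable.aemeasurable ?_
    simp only [prefixOf_pair_iff]
    by_cases h : prefixOf α (evens y).length = evens y
    · simp only [h, true_and]
      exact measurable_prefix_ite _ _
    · simp only [h, false_and, if_false, measurable_const]

/-- Conservation of the test for `λ` under projection. -/
theorem exists_lintegral_testLam_pair_le {m : List Bool → ℝ} (hm : IsUniversalDistr m) :
    ∃ C : ℕ, 1 ≤ C ∧ ∀ α, ∫⁻ β, testLam m (pair α β) ∂coin ≤ C * testLam m α := by
  obtain ⟨C, hC⟩ := hm.2 _ (hm.1.push primrec_evens)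
  obtain ⟨N, hN⟩ := exists_nat_ge C
  refine ⟨N + 1, by omega, fun α => ?_⟩
  rw [lintegral_testLam_pair hm.1]
  have h : ∀ x, pushDistr evens m x ≤ ((N + 1 : ℕ) : ℝ) * m x := fun x =>
    (hC x).trans (mul_le_mul_of_nonneg_right (by push_cast; linarith) (hm.1.nonneg x))
  simpa only [ENNReal.ofReal_natCast] using testLam_mono (Nat.cast_nonneg _) h α

/-! ### Maxima of elementary functions -/

/-- The pointwise maximum of elementary functions. -/
def emax (f g : Elem) : Elem := -(emin (-f) (-g))

@[simp] theorem emax_apply (f g : Elem) (ω : W) : (emax f g).1 ω = max (f.1 ω) (g.1 ω) := by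
  simp only [emax, neg_apply, emin_apply, min_neg_neg, neg_neg]

theorem IsLattice.neg_mem {E : Set Elem} (hE : IsLattice E) {f : Elem} (hf : f ∈ E) : -f ∈ E := by
  have := hE.sub_mem hE.zero_mem hf
  rwa [zero_sub] at this

theorem IsLattice.max_mem {E : Set Elem} (hE : IsLattice E) {f g : Elem} (hf : f ∈ E)
    (hg : g ∈ E) : emax f g ∈ E :=
  hE.neg_mem (hE.min_mem _ (hE.neg_mem hf) _ (hE.neg_mem hg))

/-- The maximum of zero and the functions in a list. -/
def emaxList (l : List Elem) : Elem := l.foldr emax 0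

theorem IsLattice.emaxList_mem {E : Set Elem} (hE : IsLattice E) {l : List Elem}
    (hl : ∀ f ∈ l, f ∈ E) : emaxList l ∈ E := by
  induction l with
  | nil => exact hE.zero_mem
  | cons f l ih => exact hE.max_mem (hl f (by simp)) (ih fun g hg => hl g (by simp [hg]))

theorem le_emaxList {l : List Elem} {f : Elem} (hf : f ∈ l) : f ≤ emaxList l := by
  induction l with
  | nil => simp at hf
  | cons g l ih =>
    intro ω
    change f.1 ω ≤ (emax g (emaxList l)).1 ω
    rw [emax_apply]
    rcases List.mem_cons.1 hf with rfl | hf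
    exacts [le_max_left _ _, (ih hf ω).trans (le_max_right _ _)]

theorem emaxList_nonneg (l : List Elem) : 0 ≤ emaxList l := by
  induction l with
  | nil => exact le_rfl
  | cons g l ih =>
    intro ω
    change 0 ≤ (emax g (emaxList l)).1 ω
    rw [emax_apply]
    exact (ih ω).trans (le_max_right _ _)

theorem emaxList_apply_eq (l : List Elem) (ω : W) :
    (emaxList l).1 ω = 0 ∨ ∃ f ∈ l, (emaxList l).1 ω = f.1 ω := by
  induction l with
  | nil => exact Or.inl rfl
  | cons g l ih =>
    have h : (emaxList (g :: l)).1 ω = max (g.1 ω) ((emaxList l).1 ω) := emax_apply _ _ _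
    rw [h]
    rcases max_choice (g.1 ω) ((emaxList l).1 ω) with h1 | h1
    · exact Or.inr ⟨g, by simp, h1⟩
    · rw [h1]
      exact ih.imp id fun ⟨f, hf, h2⟩ => ⟨f, by simp [hf], h2⟩

/-! ### Mean values of tests -/

/-- The functions whose supremum is `t_E^A`. -/
def testSet (m : List Bool → ℝ) (A : W → Elem → ℝ) (E : Set Elem) : Set Elem :=
  {f | f ∈ E ∧ 0 ≤ f ∧ ∀ ξ, ENNReal.ofReal (A ξ f) ≤ testLam m ξ}

theorem le_testOf {m : List Bool → ℝ} {A : W → Elem → ℝ} {E : Set Elem} {f : Elem}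
    (hf : f ∈ testSet m A E) (ω : W) : ENNReal.ofReal (f.1 ω) ≤ testOf m A E ω :=
  le_iSup₂ (f := fun (f : Elem) (_ : f ∈ testSet m A E) => ENNReal.ofReal (f.1 ω : ℝ)) f hf

theorem zero_mem_testSet {m : List Bool → ℝ} {A : W → Elem → ℝ} {E : Set Elem}
    (hA : ∀ ω, IsSemimeasure (A ω)) (hE : (0 : Elem) ∈ E) : 0 ∈ testSet m A E :=
  ⟨hE, le_rfl, fun ξ => by simp [(hA ξ).map_zero]⟩

/-- By compactness, an elementary function below a supremum of elementary functions is, up to a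
factor, below the maximum of finitely many of them. -/
theorem exists_list_of_le_iSup {P : Set Elem} (h0 : 0 ∈ P) {C : ℕ} {k : Elem}
    (h : ∀ ω, ((k.1 ω : ℝ) : EReal) ≤
      ((C * ⨆ (f : Elem) (_ : f ∈ P), ENNReal.ofReal (f.1 ω : ℝ) : ENNReal) : EReal)) :
    ∃ l : List Elem, (∀ f ∈ l, f ∈ P) ∧ k ≤ (2 * C : ℚ) • emaxList l := by
  obtain ⟨s, hs⟩ := exists_finset_of_locally
    (P := fun (f : {f // f ∈ P}) ω => k.1 ω ≤ 2 * C * f.1.1 ω) fun ω => by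
      have key : ∃ f ∈ P, k.1 ω ≤ 2 * C * f.1 ω := by
        rcases le_or_gt (k.1 ω) 0 with hk | hk
        · exact ⟨0, h0, by simpa using hk⟩
        by_contra! hc
        have hk' : (0 : ℝ) < k.1 ω := by exact_mod_cast hk
        have h1 : (C * ⨆ (f : Elem) (_ : f ∈ P), ENNReal.ofReal (f.1 ω : ℝ) : ENNReal) ≤
            ENNReal.ofReal (k.1 ω / 2) := by
          simp only [ENNReal.mul_iSup]
          refine iSup₂_le fun f hf => ?_
          rw [← ENNReal.ofReal_natCast, ← ENNReal.ofReal_mul (Nat.cast_nonneg C)]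
          refine ENNReal.ofReal_le_ofReal ?_
          have h2 : ((2 * C * f.1 ω : ℚ) : ℝ) < k.1 ω := by exact_mod_cast hc f hf
          push_cast at h2
          linarith
        have h3 := (h ω).trans (EReal.coe_ennreal_le_coe_ennreal_iff.2 h1)
        rw [EReal.coe_ennreal_ofReal, max_eq_left (by linarith), EReal.coe_le_coe_iff] at h3
        linarith
      obtain ⟨f, hf, hkf⟩ := key
      obtain ⟨n, hn⟩ := exists_hasModulus k
      obtain ⟨n', hn'⟩ := exists_hasModulus f
      refine ⟨⟨f, hf⟩, max n n', fun ξ hξ => ?_⟩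
      rw [hn.mono (le_max_left n n') _ _ hξ, hn'.mono (le_max_right n n') _ _ hξ]
      exact hkf
  refine ⟨s.toList.map Subtype.val, ?_, fun ω => ?_⟩
  · intro f hf
    obtain ⟨g, -, rfl⟩ := List.mem_map.1 hf
    exact g.2
  · obtain ⟨f, hf, h1⟩ := hs ω
    refine h1.trans ?_
    change _ ≤ 2 * C * (emaxList _).1 ω
    exact mul_le_mul_of_nonneg_left
      (le_emaxList (List.mem_map_of_mem (Finset.mem_toList.2 hf)) ω) (by positivity)

/-- To bound the mean of a test, it is enough to bound the means of finite maxima of functions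
defining a larger test. -/
theorem innerExt_testOf_le {m : List Bool → ℝ} {E : Set Elem} {ν : Elem → ℝ} {V B : W → Elem → ℝ}
    (hν : IsSemimeasure ν) {C : ℕ} (hC : 1 ≤ C)
    (hV : ∀ ω, testOf m V E ω ≤ C * testOf m B E ω) (h0 : 0 ∈ testSet m B E) {r : ENNReal}
    (h : ∀ l : List Elem, (∀ f ∈ l, f ∈ testSet m B E) → ENNReal.ofReal (ν (emaxList l)) ≤ r) :
    (innerExt ν fun ω => (testOf m V E ω : EReal)).toENNReal ≤ ((2 * C : ℕ) : ENNReal) * r := by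
  refine (EReal.toENNReal_le_toENNReal (y := ((((2 * C : ℕ) : ENNReal) * r : ENNReal) : EReal))
    ?_).trans EReal.toENNReal_coe.le
  refine iSup₂_le fun k hk => ?_
  obtain ⟨l, hl, hkl⟩ := exists_list_of_le_iSup h0 (C := C) (k := k) fun ω =>
    (hk ω).trans (EReal.coe_ennreal_le_coe_ennreal_iff.2 (hV ω))
  have hC0 : (0 : ℚ) < 2 * C := by
    have : (1 : ℚ) ≤ C := by exact_mod_cast hC
    linarith
  have h1 := hν.mono hkl
  rw [hν.map_smul hC0] at h1
  have h2 : ENNReal.ofReal (ν k) ≤ ((2 * C : ℕ) : ENNReal) * r := by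
    refine (ENNReal.ofReal_le_ofReal h1).trans ?_
    rw [ENNReal.ofReal_mul (by exact_mod_cast hC0.le)]
    refine mul_le_mul' (le_of_eq ?_) (h l hl)
    rw [← ENNReal.ofReal_natCast]
    push_cast
    rfl
  refine le_trans ?_ (EReal.coe_ennreal_le_coe_ennreal_iff.2 h2)
  rw [EReal.coe_ennreal_ofReal, EReal.coe_le_coe_iff]
  exact le_max_left _ _

theorem ofReal_le_innerExt_testOf {m : List Bool → ℝ} {E : Set Elem} {ν : Elem → ℝ}
    {U : W → Elem → ℝ} (hν : IsSemimeasure ν) {K : ℕ} (hK : 1 ≤ K) {f : Elem}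
    (hf : ∀ ω, ENNReal.ofReal (f.1 ω) ≤ K * testOf m U E ω) :
    ENNReal.ofReal (ν f) ≤ K * (innerExt ν fun ω => (testOf m U E ω : EReal)).toENNReal := by
  have hK0 : (0 : ℚ) < K := by exact_mod_cast hK
  have hK0' : (0 : ℝ) < K := by exact_mod_cast hK
  set g : Elem := (K : ℚ)⁻¹ • f
  have hg : ∀ ω, ((g.1 ω : ℝ) : EReal) ≤ testOf m U E ω := fun ω => by
    have h1 : ENNReal.ofReal (g.1 ω) ≤ testOf m U E ω := by
      have h2 : (f.1 ω : ℝ) = K * g.1 ω := by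
        simp only [g, smul_apply]
        push_cast
        rw [mul_inv_cancel_left₀ hK0'.ne']
      have h3 := hf ω
      rw [h2, ENNReal.ofReal_mul hK0'.le, ENNReal.ofReal_natCast] at h3
      exact (ENNReal.mul_le_mul_iff_right (by exact_mod_cast (by omega : K ≠ 0))
        (ENNReal.natCast_ne_top K)).1 h3
    refine le_trans ?_ (EReal.coe_ennreal_le_coe_ennreal_iff.2 h1)
    rw [EReal.coe_ennreal_ofReal, EReal.coe_le_coe_iff]
    exact le_max_left _ _
  have h1 : ν f = K * ν g := by
    have := hν.map_smul (inv_pos.2 hK0) f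
    rw [this]
    push_cast
    rw [mul_inv_cancel_left₀ hK0'.ne']
  rw [h1, ENNReal.ofReal_mul hK0'.le, ENNReal.ofReal_natCast]
  refine mul_le_mul_right ?_ _
  have h2 := EReal.toENNReal_le_toENNReal (le_innerExt ν hg)
  rwa [EReal.toENNReal_of_ne_top (EReal.coe_ne_top _), EReal.toReal_coe] at h2

theorem exists_nat_testOf_le {m : List Bool → ℝ} {μ : Elem → ℝ} {V B : W → Elem → ℝ}
    (hV : IsUniversalGenerator m μ V) (hB : IsGenerator μ B) :
    ∃ C : ℕ, 1 ≤ C ∧ ∀ E : Set Elem, (∀ c : ℚ, 0 ≤ c → ∀ f ∈ E, c • f ∈ E) →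
      ∀ ω, testOf m V E ω ≤ C * testOf m B E ω := by
  obtain ⟨C, hC⟩ := hV.2 B hB
  obtain ⟨N, hN⟩ := exists_nat_ge C
  refine ⟨N + 1, by omega, fun E hE ω => (hC E hE ω).trans (mul_le_mul_left ?_ _)⟩
  have h1 : (C : ENNReal) ≤ ((N : NNReal) : ENNReal) := ENNReal.coe_le_coe.2 hN
  refine h1.trans ?_
  push_cast
  exact le_self_add

/-! ### Coarse grainings -/

theorem posLE_lowerExt {E : Set Elem} {φ : Elem → ℝ} (hφ : IsSemimeasure φ) :
    PosLE (lowerExt E φ) φ := by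
  intro f hf
  refine csSup_le (lowerSet_nonempty φ f) ?_
  rintro r ⟨a, ha, b, hb, hab, rfl⟩
  have hm := hatPos_emin ha hb
  have hd := hatPos_sub ha hm (emin_le_left _ _)
  have h1 := lower_add hφ hm hd
  rw [add_sub_cancel] at h1
  have h2 := lower_mono hφ hm hb (emin_le_right _ _)
  have h3 := lower_le_mem hφ (self_mem_partSums φ hd)
  have h4 : a - emin a b ≤ f := fun ω => by
    have h5 : a.1 ω - b.1 ω ≤ f.1 ω := hab ω
    have h6 : 0 ≤ f.1 ω := hf ω
    change a.1 ω - min (a.1 ω) (b.1 ω) ≤ f.1 ω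
    rcases min_cases (a.1 ω) (b.1 ω) with h7 | h7 <;> linarith
  linarith [hφ.mono h4]

theorem IsCoarse.lower_le {E : Set Elem} {φ ψ : Elem → ℝ} (hφ : IsSemimeasure φ)
    (hψ : IsCoarse E φ ψ) {f : Elem} (hf : f ∈ hatPos E) : lower E φ f ≤ ψ f := by
  rw [← lowerExt_eq hφ hf]
  exact hψ.largest _ (isEMeasure_lowerExt hφ) (posLE_lowerExt hφ) f hf.1 hf.2

theorem subset_hat (E : Set Elem) : E ⊆ hat E := fun _ hf _ _ hS =>
  hS (Set.mem_insert_of_mem _ hf)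

theorem IsEMeasure.map_add {E : Set Elem} {ν : Elem → ℝ} (hν : IsEMeasure E ν) {f g : Elem}
    (hf : f ∈ hat E) (hg : g ∈ hat E) : ν (f + g) = ν f + ν g := by
  have := hν.linear 1 f hf g hg
  simpa using this

theorem IsEMeasure.map_list_sum {E : Set Elem} {ν : Elem → ℝ} (hν : IsEMeasure E ν) {l : List Elem}
    (hl : ∀ f ∈ l, f ∈ hat E) : l.sum ∈ hat E ∧ ν l.sum = (l.map ν).sum := by
  induction l with
  | nil => exact ⟨(isLattice_latticeSpan _).zero_mem, hν.semimeasure.map_zero⟩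
  | cons f l ih =>
    obtain ⟨h1, h2⟩ := ih fun g hg => hl g (by simp [hg])
    have hf := hl f (by simp)
    simp only [List.sum_cons, List.map_cons]
    exact ⟨(isLattice_latticeSpan _).add_mem _ hf _ h1, by rw [hν.map_add hf h1, h2]⟩

/-! ### Suprema of elementary functions and enumerable operators -/

theorem isSupOf_univ {g : W → ℝ} (h0 : ∀ ω, 0 ≤ g ω) (h : ∀ ω (q : ℚ), (q : ℝ) < g ω →
    ∃ n, ∀ ξ, prefixOf ξ n = prefixOf ω n → (q : ℝ) < g ξ) : IsSupOf Set.univ g := by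
  refine ⟨{f | ∀ ω, (f.1 ω : ℝ) ≤ g ω}, Set.subset_univ _, fun ω => ⟨?_, fun r hr => ?_⟩⟩
  · rintro _ ⟨f, hf, rfl⟩
    exact hf ω
  · refine le_of_forall_rat_lt_imp_le fun q hq => ?_
    obtain ⟨n, hn⟩ := h ω q hq
    rcases le_or_gt q 0 with hq0 | hq0
    · refine le_trans ?_ (hr ⟨0, fun ω => by simpa using h0 ω, rfl⟩)
      simpa using hq0
    · refine hr ⟨q • cylinder (prefixOf ω n), fun ξ => ?_, ?_⟩
      · rw [smul_apply, cylinder_apply, length_prefixOf]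
        split_ifs with h1
        · simpa using (hn ξ h1).le
        · simpa using h0 ξ
      · simp [cylinder_apply]

theorem IsEnumerableOp.isSupOf {A : W → Elem → ℝ} (hA : ∀ ω, IsSemimeasure (A ω))
    (hE : IsEnumerableOp A) {f : Elem} (hf : 0 ≤ f) : IsSupOf Set.univ fun ω => A ω f := by
  obtain ⟨R, -, hR⟩ := hE
  obtain ⟨l, rfl⟩ := ElemCode.exists_val_eq f
  refine isSupOf_univ (fun ω => (hA ω).nonneg _ hf) fun ω q hq => ?_
  obtain ⟨r, rfl⟩ := RatCode.exists_val_eq q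
  obtain ⟨n, hn⟩ := (hR l hf r ω).1 hq
  exact ⟨n, fun ξ hξ => (hR l hf r ξ).2 ⟨n, hξ ▸ hn⟩⟩

theorem IsSupOf.locally_lt {g : W → ℝ} (hg : IsSupOf Set.univ g) {ω : W} {r : ℝ} (hr : r < g ω) :
    ∃ n, ∀ ξ, prefixOf ξ n = prefixOf ω n → r < g ξ := by
  obtain ⟨S, -, hS⟩ := hg
  obtain ⟨_, ⟨f, hf, rfl⟩, h1⟩ := (lt_isLUB_iff (hS ω)).1 hr
  obtain ⟨n, hn⟩ := exists_hasModulus f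
  refine ⟨n, fun ξ hξ => lt_of_lt_of_le ?_ ((hS ξ).1 ⟨f, hf, rfl⟩)⟩
  simpa [hn _ _ hξ] using h1

/-! ### Slices, averages and products of elementary functions -/

theorem prefixOf_pair_congr {α α' β β' : W} {n : ℕ} (hα : prefixOf α n = prefixOf α' n)
    (hβ : prefixOf β n = prefixOf β' n) : prefixOf (pair α β) n = prefixOf (pair α' β') n := by
  rw [prefixOf_eq_iff] at *
  intro i hi
  have h : i / 2 < n := lt_of_le_of_lt (Nat.div_le_self i 2) hi
  unfold pair
  rw [hα _ h, hβ _ h]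

/-- The function `α ↦ h (α, β)`. -/
def colslice (h : Elem) (β : W) : Elem :=
  ⟨fun α => h.1 (pair α β), by
    obtain ⟨n, hn⟩ := exists_hasModulus h
    exact ⟨n, fun α α' hα => hn _ _ (prefixOf_pair_congr (prefixOf_eq_iff.2 hα) rfl)⟩⟩

@[simp] theorem colslice_apply (h : Elem) (α β : W) :
    (colslice h β).1 α = h.1 (pair α β) := rfl

theorem hasModulus_slice {h : Elem} {n : ℕ} (hn : HasModulus h n) (α : W) :
    HasModulus (slice h α) n := fun _ _ hβ => hn _ _ (prefixOf_pair_congr rfl hβ)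

theorem HasModulus.colslice_pad {h : Elem} {n : ℕ} (hn : HasModulus h n) (β : W) :
    colslice h (pad (prefixOf β n)) = colslice h β :=
  elem_ext fun _ => hn _ _ (prefixOf_pair_congr rfl (by simpa using prefixOf_pad (prefixOf β n)))

theorem colslice_mem_of_mem_tensor {E : Set Elem} (hE : IsLattice E) {h : Elem}
    (hh : h ∈ tensor E) (β : W) : colslice h β ∈ E := by
  refine hh {h | colslice h β ∈ E} ⟨hE.zero_mem, fun f hf g hg => hE.add_mem _ hf _ hg,
    fun c f hf => hE.smul_mem c _ hf, fun f hf g hg => hE.min_mem _ hf _ hg⟩ ?_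
  rintro h ⟨f, hf, g, hfg⟩
  have : colslice h β = g.1 β • f := elem_ext fun α => by simp [hfg, mul_comm]
  rw [Set.mem_ofPred_eq, this]
  exact hE.smul_mem _ _ hf

/-- The average of `h (α, β)` over the first `n` digits of `β`. -/
def average (n : ℕ) (h : Elem) : Elem :=
  ∑ x ∈ (strings n).toFinset, ((2 : ℚ)⁻¹ ^ n) • colslice h (pad x)

theorem average_apply (n : ℕ) (h : Elem) (α : W) : (average n h).1 α =
    ∑ x ∈ (strings n).toFinset, (2 : ℚ)⁻¹ ^ n * h.1 (pair α (pad x)) := by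
  simp [average]

theorem HasModulus.average_eq_lam {h : Elem} {n : ℕ} (hn : HasModulus h n) (α : W) :
    ((average n h).1 α : ℝ) = lam (slice h α) := by
  rw [(hasModulus_slice hn α).lam_eq, average_apply]
  push_cast
  rfl

theorem average_nonneg (n : ℕ) {h : Elem} (hh : 0 ≤ h) : 0 ≤ average n h := fun α => by
  change 0 ≤ (average n h).1 α
  rw [average_apply]
  exact Finset.sum_nonneg fun x _ => mul_nonneg (by positivity) (hh _)

theorem average_sum (n : ℕ) {ι : Type*} (s : Finset ι) (c : ι → ℚ) (f : ι → Elem) :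
    average n (∑ i ∈ s, c i • f i) = ∑ i ∈ s, c i • average n (f i) := elem_ext fun α => by
  simp only [average_apply, sum_apply, smul_apply, Finset.mul_sum]
  rw [Finset.sum_comm]
  refine Finset.sum_congr rfl fun i _ => Finset.sum_congr rfl fun x _ => ?_
  ring

theorem hasModulus_cylinder (z : List Bool) : HasModulus (cylinder z) z.length := fun α β h => by
  simp [cylinder_apply, h]

theorem average_cylinder (z : List Bool) :
    average z.length (cylinder z) = ((2 : ℚ)⁻¹ ^ (odds z).length) • cylinder (evens z) :=
  elem_ext fun α => by
    rw [← Rat.cast_inj (α := ℝ), (hasModulus_cylinder z).average_eq_lam]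
    have : slice (cylinder z) α = (cylinder (evens z)).1 α • cylinder (odds z) :=
      elem_ext fun β => cylinder_pair z α β
    rw [this, lam_smul, lam_cylinder, smul_apply]
    push_cast
    ring

/-- Fubini's theorem for elementary functions. -/
theorem HasModulus.lam_average {h : Elem} {n : ℕ} (hn : HasModulus h n) :
    lam (average n h) = lam h := by
  have h1 : average n h = ∑ x ∈ (strings n).toFinset, h.1 (pad x) •
      (((2 : ℚ)⁻¹ ^ (odds x).length) • cylinder (evens x)) := by
    conv_lhs => rw [hn.eq_sum]
    rw [average_sum]
    refine Finset.sum_congr rfl fun x hx => ?_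
    have hx := mem_strings.1 (List.mem_toFinset.1 hx)
    rw [← average_cylinder x, hx]
  rw [h1, lam_sum, hn.lam_eq]
  refine Finset.sum_congr rfl fun x hx => ?_
  have hx := mem_strings.1 (List.mem_toFinset.1 hx)
  have h2 : n = (odds x).length + (evens x).length := by
    simp only [length_evens, length_odds]
    omega
  rw [lam_smul, lam_smul, lam_cylinder, h2, pow_add]
  push_cast
  ring

theorem IsSemimeasure.sum_le {φ : Elem → ℝ} (hφ : IsSemimeasure φ) {ι : Type*} (s : Finset ι)
    (c : ι → ℚ) (hc : ∀ i, 0 ≤ c i) (f : ι → Elem) :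
    ∑ i ∈ s, c i * φ (f i) ≤ φ (∑ i ∈ s, c i • f i) := by
  classical
  induction s using Finset.induction_on with
  | empty => simp [hφ.map_zero]
  | insert i s hi ih =>
    rw [Finset.sum_insert hi, Finset.sum_insert hi]
    linarith [hφ.concave (c i) (f i) (∑ i ∈ s, c i • f i) (hc i)]

/-- The function `(α, β) ↦ f α * g β`. -/
def tprod (f g : Elem) : Elem :=
  ⟨fun ω => f.1 (evensW ω) * g.1 (oddsW ω), by
    obtain ⟨n, hn⟩ := exists_hasModulus f
    obtain ⟨k, hk⟩ := exists_hasModulus g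
    refine ⟨2 * (n + k) + 1, fun α β h => ?_⟩
    beta_reduce
    rw [hn (evensW α) (evensW β) (prefixOf_eq_iff.2 fun i hi => h _ (by omega)),
      hk (oddsW α) (oddsW β) (prefixOf_eq_iff.2 fun i hi => h _ (by omega))]⟩

theorem tprod_apply (f g : Elem) (ω : W) :
    (tprod f g).1 ω = f.1 (evensW ω) * g.1 (oddsW ω) := rfl

theorem tprod_mem_tensor {E : Set Elem} {f : Elem} (hf : f ∈ E) (g : Elem) :
    tprod f g ∈ tensor E := fun _ _ hS => hS ⟨f, hf, g, fun α β => by simp [tprod_apply]⟩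

theorem isLattice_tensor (E : Set Elem) : IsLattice (tensor E) := isLattice_latticeSpan _

theorem tprod_unity_mem_hat {E : Set Elem} {f : Elem} (hf : f ∈ hat E) :
    tprod f unity ∈ hat (tensor E) := by
  have hL : IsLattice (hat (tensor E)) := isLattice_latticeSpan _
  refine hf {f | tprod f unity ∈ hat (tensor E)} ⟨?_, fun f hf g hg => ?_, fun c f hf => ?_,
    fun f hf g hg => ?_⟩ ?_
  · have : tprod 0 unity = 0 := elem_ext fun ω => by simp [tprod_apply]
    rw [Set.mem_ofPred_eq, this]
    exact hL.zero_mem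
  · have : tprod (f + g) unity = tprod f unity + tprod g unity :=
      elem_ext fun ω => by simp [tprod_apply]
    rw [Set.mem_ofPred_eq, this]
    exact hL.add_mem _ hf _ hg
  · have : tprod (c • f) unity = c • tprod f unity := elem_ext fun ω => by simp [tprod_apply]
    rw [Set.mem_ofPred_eq, this]
    exact hL.smul_mem _ _ hf
  · have : tprod (emin f g) unity = emin (tprod f unity) (tprod g unity) :=
      elem_ext fun ω => by simp [tprod_apply]
    rw [Set.mem_ofPred_eq, this]
    exact hL.min_mem _ hf _ hg
  · rintro f (rfl | hf)
    · have : tprod unity unity = unity := elem_ext fun ω => by simp [tprod_apply]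
      rw [Set.mem_ofPred_eq, this]
      exact one_mem_hat _
    · exact subset_hat _ (tprod_mem_tensor hf _)

theorem cylinder_nonneg_le (x : List Bool) (ω : W) :
    0 ≤ (cylinder x).1 ω ∧ (cylinder x).1 ω ≤ 1 := by
  rw [cylinder_apply]
  split_ifs <;> simp

/-- Although the unity of `α` times a cylinder of `β` need not be in the lattice generated by
`E ⊗ 𝓔` and the unity, functions of `hat E` bounded by functions of `E` can be localized. -/
theorem tprod_cylinder_mem_hat {E : Set Elem} {f F : Elem} (hf : f ∈ hatPos E) (hF : F ∈ E)
    (h : f ≤ F) (x : List Bool) : tprod f (cylinder x) ∈ hat (tensor E) := by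
  have hL : IsLattice (hat (tensor E)) := isLattice_latticeSpan _
  have h1 : tprod f (cylinder x) = emin (tprod f unity) (tprod F (cylinder x)) :=
    elem_ext fun ω => by
      simp only [tprod_apply, emin_apply, unity_apply, mul_one]
      have h2 : 0 ≤ f.1 (evensW ω) := hf.2 _
      have h3 : f.1 (evensW ω) ≤ F.1 (evensW ω) := h _
      rw [cylinder_apply]
      split_ifs
      · simp [h3]
      · simp [h2]
  rw [h1]
  exact hL.min_mem _ (tprod_unity_mem_hat hf.1) _ (subset_hat _ (tprod_mem_tensor hF _))

theorem prodS_tprod {φ : Elem → ℝ} (hφ : IsSemimeasure φ) (f : Elem) (x : List Bool) :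
    prodS φ lam (tprod f (cylinder x)) = (2 : ℝ)⁻¹ ^ x.length * φ f := by
  have h1 : ∀ α, lam (slice (tprod f (cylinder x)) α) =
      ((((2 : ℚ)⁻¹ ^ x.length) • f).1 α : ℝ) := fun α => by
    have : slice (tprod f (cylinder x)) α = f.1 α • cylinder x :=
      elem_ext fun β => by simp [tprod_apply]
    rw [this, lam_smul, lam_cylinder, smul_apply]
    push_cast
    ring
  change inner φ (fun α => lam (slice (tprod f (cylinder x)) α)) = _
  simp only [h1]
  rw [inner_elem hφ, hφ.map_smul (by positivity)]
  push_cast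
  rfl

theorem lower_sum {E : Set Elem} {φ : Elem → ℝ} (hφ : IsSemimeasure φ) {ι : Type*} (s : Finset ι)
    {c : ℚ} (hc : 0 < c) (f : ι → Elem) (hf : ∀ i, f i ∈ hatPos E) :
    ∑ i ∈ s, c • f i ∈ hatPos E ∧
      lower E φ (∑ i ∈ s, c • f i) = ∑ i ∈ s, c * lower E φ (f i) := by
  classical
  induction s using Finset.induction_on with
  | empty => simpa using ⟨hatPos_zero, lower_zero hφ⟩
  | insert i s hi ih =>
    rw [Finset.sum_insert hi, Finset.sum_insert hi]
    have h1 := hatPos_smul hc.le (hf i)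
    exact ⟨hatPos_add h1 ih.1, by rw [lower_add hφ h1 ih.1, ih.2, lower_smul hφ hc (hf i)]⟩

theorem le_list_sum {E : Set Elem} {l : List Elem} (hl : ∀ f ∈ l, f ∈ hatPos E) {f : Elem}
    (hf : f ∈ l) : f ≤ l.sum := by
  induction l with
  | nil => simp at hf
  | cons g l ih =>
    rw [List.sum_cons]
    have h1 := (hatPos_sum l fun k hk => hl k (by simp [hk])).2
    have h2 := (hl g (by simp)).2
    rcases List.mem_cons.1 hf with rfl | hf
    · exact fun ω => le_add_of_nonneg_right (h1 ω)
    · have h3 := ih (fun k hk => hl k (by simp [hk])) hf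
      exact fun ω => (h3 ω).trans (le_add_of_nonneg_left (h2 ω))

/-- An `E ⊗ 𝓔`-measure below `φ ⊗ λ` is below `φ_E ⊗ λ` on the functions of `E ⊗ 𝓔`. -/
theorem le_lower_average {E : Set Elem} (hE : IsLattice E) {φ ν : Elem → ℝ}
    (hφ : IsSemimeasure φ) (hν : IsEMeasure (tensor E) ν) (hle : PosLE ν (prodS φ lam)) {H : Elem}
    (hH : H ∈ tensor E) (hH0 : 0 ≤ H) {n : ℕ} (hn : HasModulus H n) :
    average n H ∈ hatPos E ∧ ν H ≤ lower E φ (average n H) := by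
  have hF : ∀ x : List Bool, colslice H (pad x) ∈ hatPos E := fun x =>
    ⟨subset_hat _ (colslice_mem_of_mem_tensor hE hH _), fun α => hH0 _⟩
  obtain ⟨h1, h2⟩ := lower_sum hφ (strings n).toFinset (c := (2 : ℚ)⁻¹ ^ n) (by positivity)
    (fun x => colslice H (pad x)) hF
  refine ⟨h1, ?_⟩
  change ν H ≤ lower E φ (∑ x ∈ _, _)
  rw [h2]
  have h3 : H = ((strings n).toFinset.toList.map fun x =>
      tprod (colslice H (pad x)) (cylinder x)).sum := by
    rw [Finset.sum_map_toList]
    refine elem_ext fun ω => ?_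
    rw [sum_apply]
    simp only [tprod_apply, colslice_apply]
    rw [sum_cylinder n fun x => H.1 (pair (evensW ω) (pad x))]
    have := congrArg (fun f : Elem => f.1 (evensW ω)) (hn.colslice_pad (oddsW ω))
    simpa using this.symm
  have h4 := (hν.map_list_sum (l := (strings n).toFinset.toList.map fun x =>
      tprod (colslice H (pad x)) (cylinder x)) fun f hf => by
    obtain ⟨x, -, rfl⟩ := List.mem_map.1 hf
    exact subset_hat _ (tprod_mem_tensor (colslice_mem_of_mem_tensor hE hH _) _)).2
  rw [← h3, List.map_map, Finset.sum_map_toList] at h4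
  rw [h4]
  refine Finset.sum_le_sum fun x hx => ?_
  have hx := mem_strings.1 (List.mem_toFinset.1 hx)
  have hpos : (0 : ℝ) < (2 : ℝ)⁻¹ ^ n := by positivity
  push_cast
  rw [← div_le_iff₀' hpos]
  refine le_csInf ⟨_, self_mem_partSums φ (hF x)⟩ ?_
  rintro r ⟨l, hl, hs, rfl⟩
  rw [div_le_iff₀' hpos]
  have h5 : tprod (colslice H (pad x)) (cylinder x) =
      (l.map fun f => tprod f (cylinder x)).sum := elem_ext fun ω => by
    rw [← hs, tprod_apply, list_sum_apply, list_sum_apply, List.map_map, ← List.sum_map_mul_right]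
    rfl
  have h6 := (hν.map_list_sum (l := l.map fun f => tprod f (cylinder x)) fun k hk => by
    obtain ⟨f, hf, rfl⟩ := List.mem_map.1 hk
    exact tprod_cylinder_mem_hat (hl f hf) (colslice_mem_of_mem_tensor hE hH (pad x))
      (hs ▸ le_list_sum hl hf) x).2
  simp only [Function.comp_apply]
  rw [h5, h6, List.map_map, ← List.sum_map_mul_left]
  refine List.sum_le_sum fun f hf => ?_
  have h7 := hle (tprod f (cylinder x)) fun ω =>
    mul_nonneg ((hl f hf).2 _) (cylinder_nonneg_le x _).1
  rw [prodS_tprod hφ, hx] at h7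
  exact h7

/-! ### Conservation under products with independent randomness -/

/-- The product of an operator with the identity, `(α, β) ↦ U(α) ⊗ δ_β`. -/
def sliceOp (U : W → Elem → ℝ) (ω : W) (f : Elem) : ℝ := U (evensW ω) (colslice f (oddsW ω))

theorem isSemimeasure_sliceOp {U : W → Elem → ℝ} (hU : ∀ ω, IsSemimeasure (U ω)) (ω : W) :
    IsSemimeasure (sliceOp U ω) where
  normal := (hU _).normal
  nonneg := fun _ hf => (hU _).nonneg _ fun _ => hf _
  concave := fun c f g hc => (hU _).concave c (colslice f _) (colslice g _) hc

/-- A code of `h (·, β)` for the elementary function `h` coded by `l`; the digits of `β` are those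
of `y` at odd places. -/
def sliceCode (l : ElemCode) (y : List Bool) : ElemCode :=
  l.map fun p => (evens p.1,
    if (odds y).take (odds p.1).length = odds p.1 then p.2 else (0, 0, 0))

theorem primrec_sliceCode : Primrec₂ sliceCode := by
  have h1 : Primrec fun a : (ElemCode × List Bool) × (List Bool × RatCode) => odds a.2.1 :=
    primrec_odds.comp (Primrec.fst.comp Primrec.snd)
  have h2 : Primrec fun a : (ElemCode × List Bool) × (List Bool × RatCode) => (evens a.2.1,
      if (odds a.1.2).take (odds a.2.1).length = odds a.2.1 then a.2.2 else (0, 0, 0)) :=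
    Primrec.pair (primrec_evens.comp (Primrec.fst.comp Primrec.snd))
      (Primrec.ite (Primrec.eq.comp (Primrec.list_take.comp (Primrec.list_length.comp h1)
        (primrec_odds.comp (Primrec.snd.comp Primrec.fst))) h1)
        (Primrec.snd.comp Primrec.snd) (Primrec.const _))
  exact Primrec.list_map Primrec.fst h2.to₂

theorem sliceCode_prefixOf {l : ElemCode} {n : ℕ} (h : ∀ p ∈ l, p.1.length ≤ n) (ω : W) :
    sliceCode l (prefixOf ω n) = l.map fun p => (evens p.1,
      if prefixOf (oddsW ω) (odds p.1).length = odds p.1 then p.2 else (0, 0, 0)) := by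
  refine List.map_congr_left fun p hp => ?_
  have h1 : (odds p.1).length ≤ n / 2 := by
    rw [length_odds]
    exact Nat.div_le_div_right (h p hp)
  rw [odds_prefixOf, take_prefixOf, min_eq_left h1]

theorem val_sliceCode {l : ElemCode} {n : ℕ} (h : ∀ p ∈ l, p.1.length ≤ n) (ω : W) :
    (sliceCode l (prefixOf ω n)).val = colslice l.val (oddsW ω) := by
  rw [sliceCode_prefixOf h]
  clear h
  induction l with
  | nil => rfl
  | cons p l ih =>
    rw [List.map_cons, ElemCode.val_cons, ih]
    refine elem_ext fun α => ?_
    simp only [colslice_apply, add_apply, ElemCode.val_cons, smul_apply, cylinder_pair,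
      cylinder_apply (odds p.1)]
    split_ifs <;> simp

theorem exists_length_bound (l : ElemCode) : ∃ n, ∀ p ∈ l, p.1.length ≤ n :=
  ⟨(l.map fun p => p.1.length).foldr max 0, fun _ hp =>
    List.le_max_of_le' 0 (List.mem_map_of_mem hp) le_rfl⟩

theorem isEnumerableOp_sliceOp {U : W → Elem → ℝ} (hU : IsEnumerableOp U) :
    IsEnumerableOp (sliceOp U) := by
  obtain ⟨R, hR, hRU⟩ := hU
  refine ⟨fun a => (∀ p ∈ a.1, p.1.length ≤ a.2.1.length) ∧
    ∃ j : ℕ, R (sliceCode a.1 a.2.1, (evens a.2.1).take j, a.2.2), ?_, ?_⟩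
  · have h1 : Primrec fun a : (ElemCode × List Bool × RatCode) × ℕ => a.1.2.1 :=
      Primrec.fst.comp (Primrec.snd.comp Primrec.fst)
    have h2 : Primrec fun a : (ElemCode × List Bool × RatCode) × ℕ =>
        (sliceCode a.1.1 a.1.2.1, (evens a.1.2.1).take a.2, a.1.2.2) :=
      Primrec.pair (primrec_sliceCode.comp (Primrec.fst.comp Primrec.fst) h1)
        (Primrec.pair (Primrec.list_take.comp Primrec.snd (primrec_evens.comp h1))
          (Primrec.snd.comp (Primrec.snd.comp Primrec.fst)))
    exact REPred.and (REPred.of_primrec (primrec_bounded_lengths.comp Primrec.fst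
      (Primrec.list_length.comp (Primrec.fst.comp Primrec.snd)))) (hR.comp h2).exists
  · intro l hl q ω
    have hl' : 0 ≤ colslice l.val (oddsW ω) := fun α => hl _
    simp only [length_prefixOf, evens_prefixOf, take_prefixOf, sliceOp]
    constructor
    · intro h
      obtain ⟨n, hn⟩ := exists_length_bound l
      rw [← val_sliceCode hn, hRU _ (by rwa [val_sliceCode hn])] at h
      obtain ⟨j, hj⟩ := h
      have hn' : ∀ p ∈ l, p.1.length ≤ max n (2 * j) := fun p hp =>
        (hn p hp).trans (le_max_left _ _)
      refine ⟨max n (2 * j), hn', j, ?_⟩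
      rw [sliceCode_prefixOf hn', ← sliceCode_prefixOf hn, min_eq_left (by omega)]
      exact hj
    · rintro ⟨n, hn, j, hj⟩
      rw [← val_sliceCode hn, hRU _ (by rwa [val_sliceCode hn])]
      exact ⟨_, hj⟩

theorem output_sliceOp_le {μ : Elem → ℝ} (hμ : IsSemimeasure μ) {U : W → Elem → ℝ}
    (hU : ∀ ω, IsSemimeasure (U ω)) (hle : PosLE (output U lam) μ) :
    PosLE (output (sliceOp U) lam) (prodS μ lam) := by
  intro h hh
  obtain ⟨n', hn'⟩ := exists_hasModulus h
  refine inner_le isSemimeasure_lam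
    (IsSemimeasure.exists_bound (isSemimeasure_sliceOp hU) h) fun k hk => ?_
  obtain ⟨n'', hn''⟩ := exists_hasModulus k
  obtain ⟨n, hn, hn1⟩ : ∃ n, HasModulus h n ∧ HasModulus k n :=
    ⟨max n' n'', hn'.mono (le_max_left _ _), hn''.mono (le_max_right _ _)⟩
  have h1 : prodS μ lam h = μ (average n h) := by
    change inner μ (fun α => lam (slice h α)) = _
    simp only [← hn.average_eq_lam]
    exact inner_elem hμ _
  rw [h1, ← hn1.lam_average]
  refine le_trans ?_ (hle _ (average_nonneg n hh))
  refine le_inner isSemimeasure_lam (IsSemimeasure.exists_bound hU _) fun α => ?_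
  refine le_trans ?_ ((hU α).sum_le (strings n).toFinset (fun _ => (2 : ℚ)⁻¹ ^ n)
    (fun _ => by positivity) fun x => colslice h (pad x))
  rw [average_apply]
  push_cast
  refine Finset.sum_le_sum fun x _ => mul_le_mul_of_nonneg_left ?_ (by positivity)
  simpa [sliceOp] using hk (pair α (pad x))

theorem IsGenerator.sliceOp {μ : Elem → ℝ} (hμ : IsSemimeasure μ) {U : W → Elem → ℝ}
    (hU : IsGenerator μ U) : IsGenerator (prodS μ lam) (sliceOp U) where
  operator := ⟨isSemimeasure_sliceOp hU.operator.semimeasure, fun _ hf =>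
    (isEnumerableOp_sliceOp hU.enum).isSupOf (isSemimeasure_sliceOp hU.operator.semimeasure) hf⟩
  deterministic := fun _ f g => hU.deterministic _ (colslice f _) (colslice g _)
  enum := isEnumerableOp_sliceOp hU.enum
  le := output_sliceOp_le hμ hU.operator.semimeasure hU.le

/-- Finitely many nonnegative functions of a lattice, when scaled to the same value at a point, have
a common nonnegative minorant in the lattice with this value at the point. -/
theorem exists_minorant {E : Set Elem} (hE : IsLattice E) {G : Elem} (hG : G ∈ E) (hG0 : 0 ≤ G)
    {γ : W} (l : List Elem) (hl : ∀ F ∈ l, F ∈ E ∧ 0 ≤ F) :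
    ∃ e ∈ E, 0 ≤ e ∧ e.1 γ = G.1 γ ∧ ∀ F ∈ l, 0 < F.1 γ → F.1 γ • e ≤ G.1 γ • F := by
  induction l with
  | nil => exact ⟨G, hG, hG0, rfl, by simp⟩
  | cons F l ih =>
    obtain ⟨e, he, he0, heγ, h⟩ := ih fun F' hF' => hl F' (by simp [hF'])
    obtain ⟨hF, hF0⟩ := hl F (by simp)
    rcases le_or_gt (F.1 γ) 0 with h0 | h0
    · refine ⟨e, he, he0, heγ, fun F' hF' h1 => ?_⟩
      rcases List.mem_cons.1 hF' with rfl | hF'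
      exacts [absurd h1 (not_lt.2 h0), h F' hF' h1]
    have hGγ : 0 ≤ G.1 γ := hG0 γ
    refine ⟨emin e ((G.1 γ / F.1 γ) • F), hE.min_mem _ he _ (hE.smul_mem _ _ hF),
      le_emin he0 (smul_nonneg_elem (by positivity) hF0), ?_, fun F' hF' h1 ω => ?_⟩
    · rw [emin_apply, smul_apply, div_mul_cancel₀ _ h0.ne', heγ, min_self]
    · change F'.1 γ * min (e.1 ω) (G.1 γ / F.1 γ * F.1 ω) ≤ G.1 γ * F'.1 ω
      rcases List.mem_cons.1 hF' with rfl | hF'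
      · refine (mul_le_mul_of_nonneg_left (min_le_right _ _) h0.le).trans (le_of_eq ?_)
        field_simp
      · exact (mul_le_mul_of_nonneg_left (min_le_left _ _) h1.le).trans (h F' hF' h1 ω)

theorem ofReal_le_mul_testOf {m : List Bool → ℝ} {E : Set Elem} (hE : IsLattice E)
    {U : W → Elem → ℝ} (hU : ∀ ω, IsSemimeasure (U ω)) {C : ℕ} (hC : 1 ≤ C) {e : Elem}
    (he : e ∈ E) (he0 : 0 ≤ e) (h : ∀ ω, ENNReal.ofReal (U ω e) ≤ C * testLam m ω) (γ : W) :
    ENNReal.ofReal (e.1 γ) ≤ C * testOf m U E γ := by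
  have hC0 : (0 : ℚ) < (C : ℚ)⁻¹ := inv_pos.2 (by exact_mod_cast hC)
  have hC' : (C : ENNReal) ≠ 0 := by exact_mod_cast (by omega : C ≠ 0)
  have h1 : ∀ r : ℝ, ENNReal.ofReal (((C : ℚ)⁻¹ : ℚ) * r) = (C : ENNReal)⁻¹ * ENNReal.ofReal r :=
    fun r => by
      rw [ENNReal.ofReal_mul (by positivity)]
      push_cast
      rw [ENNReal.ofReal_inv_of_pos (by exact_mod_cast hC), ENNReal.ofReal_natCast]
  have h2 : (C : ℚ)⁻¹ • e ∈ testSet m U E := by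
    refine ⟨hE.smul_mem _ _ he, smul_nonneg_elem hC0.le he0, fun ξ => ?_⟩
    rw [(hU ξ).map_smul hC0, h1]
    refine (mul_le_mul_right (h ξ) _).trans_eq ?_
    rw [← mul_assoc, ENNReal.inv_mul_cancel hC' (ENNReal.natCast_ne_top C), one_mul]
  have h3 := le_testOf h2 γ
  rw [smul_apply, Rat.cast_mul, h1] at h3
  calc ENNReal.ofReal (e.1 γ) = C * ((C : ENNReal)⁻¹ * ENNReal.ofReal (e.1 γ)) := by
        rw [← mul_assoc, ENNReal.mul_inv_cancel hC' (ENNReal.natCast_ne_top C), one_mul]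
    _ ≤ _ := mul_le_mul_right h3 _

/-- Averages over `β` of maxima of functions defining `t_{E ⊗ 𝓔}` are bounded by `t_E`. Operators
being only concave, the average itself need not be (up to a factor) among the functions defining
`t_E`; but it agrees at any given point with a smaller function that is. -/
theorem average_le_testOf {m : List Bool → ℝ} {E : Set Elem} (hE : IsLattice E)
    {U : W → Elem → ℝ} (hU : ∀ ω, IsSemimeasure (U ω)) {C : ℕ} (hC : 1 ≤ C)
    (hm : ∀ α, ∫⁻ β, testLam m (pair α β) ∂coin ≤ C * testLam m α) {l : List Elem}
    (hl : ∀ f ∈ l, f ∈ testSet m (sliceOp U) (tensor E)) {n : ℕ} (hn : ∀ f ∈ l, HasModulus f n)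
    (hH : HasModulus (emaxList l) n) (γ : W) :
    ENNReal.ofReal ((average n (emaxList l)).1 γ) ≤ C * testOf m U E γ := by
  set H := emaxList l with hHdef
  have hHE : H ∈ tensor E := (isLattice_tensor E).emaxList_mem fun f hf => (hl f hf).1
  have hGE : average n H ∈ E := by
    have h1 : ∀ s : Finset (List Bool),
        ∑ x ∈ s, ((2 : ℚ)⁻¹ ^ n) • colslice H (pad x) ∈ E := fun s => by
      classical
      induction s using Finset.induction_on with
      | empty => exact hE.zero_mem
      | insert x s hx ih =>
        rw [Finset.sum_insert hx]
        exact hE.add_mem _ (hE.smul_mem _ _ (colslice_mem_of_mem_tensor hE hHE _)) _ ih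
    exact h1 _
  obtain ⟨e, he, he0, heγ, hmin⟩ := exists_minorant hE hGE (average_nonneg n (emaxList_nonneg l))
    (γ := γ) (l.flatMap fun f => (strings n).map fun x => colslice f (pad x)) fun F hF => by
      obtain ⟨f, hf, hF⟩ := List.mem_flatMap.1 hF
      obtain ⟨x, -, rfl⟩ := List.mem_map.1 hF
      exact ⟨colslice_mem_of_mem_tensor hE (hl f hf).1 _, fun α => (hl f hf).2.1 _⟩
  set c := (average n H).1 γ with hc
  rcases le_or_gt c 0 with hc0 | hc0
  · rw [ENNReal.ofReal_of_nonpos (by exact_mod_cast hc0)]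
    exact zero_le
  have hc0' : (0 : ℝ) < c := by exact_mod_cast hc0
  rw [← heγ]
  refine ofReal_le_mul_testOf hE hU hC he he0 (fun α => ?_) γ
  have hUe : 0 ≤ U α e := (hU α).nonneg e he0
  have h1 : ∀ β, ENNReal.ofReal ((slice H γ).1 β * (U α e / c)) ≤ testLam m (pair α β) := by
    intro β
    rcases emaxList_apply_eq l (pair γ β) with h0 | ⟨f, hf, h0⟩
    · rw [slice_apply, hHdef, h0]
      simp
    rw [slice_apply, hHdef, h0]
    rcases le_or_gt (f.1 (pair γ β)) 0 with hf0 | hf0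
    · rw [ENNReal.ofReal_of_nonpos]
      · exact zero_le
      · exact mul_nonpos_of_nonpos_of_nonneg (by exact_mod_cast hf0) (div_nonneg hUe hc0'.le)
    have hmem : colslice f β ∈ l.flatMap fun f => (strings n).map fun x => colslice f (pad x) :=
      List.mem_flatMap.2 ⟨f, hf, List.mem_map.2 ⟨prefixOf β n, mem_strings.2 (by simp),
        (hn f hf).colslice_pad β⟩⟩
    have h2 := (hU α).mono (hmin _ hmem hf0)
    rw [colslice_apply, (hU α).map_smul hf0, (hU α).map_smul hc0] at h2
    refine le_trans (ENNReal.ofReal_le_ofReal ?_) ((hl f hf).2.2 (pair α β))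
    rw [← mul_div_assoc, div_le_iff₀' hc0']
    simpa [sliceOp] using h2
  refine le_trans (le_of_eq ?_) ((lintegral_mono h1).trans (hm α))
  rw [← ofReal_integral_eq_lintegral_ofReal ((integrable_elem _).mul_const _)
    (Filter.Eventually.of_forall fun β => ?_)]
  · rw [integral_mul_const]
    congr 1
    have h3 : lam (slice H γ) = c := (hH.average_eq_lam γ).symm
    change _ = lam (slice H γ) * _
    rw [h3, mul_div_cancel₀ _ hc0'.ne']
  · have : 0 ≤ H.1 (pair γ β) := emaxList_nonneg l _
    exact mul_nonneg (by exact_mod_cast this) (div_nonneg hUe hc0'.le)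

theorem isSemimeasure_prodS {φ : Elem → ℝ} (hφ : IsSemimeasure φ) :
    IsSemimeasure (prodS φ lam) := by
  refine isSemimeasure_inner hφ (G := fun α f => lam (slice f α)) fun α => ?_
  exact ⟨isSemimeasure_lam.normal, fun f hf => isSemimeasure_lam.nonneg _ fun β => hf _,
    fun c f g hc => isSemimeasure_lam.concave c (slice f α) (slice g α) hc⟩

theorem exists_common_modulus (l : List Elem) : ∃ n, ∀ f ∈ l, HasModulus f n := by
  induction l with
  | nil => exact ⟨0, by simp⟩
  | cons f l ih =>
    obtain ⟨n, hn⟩ := ih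
    obtain ⟨k, hk⟩ := exists_hasModulus f
    refine ⟨max n k, fun g hg => ?_⟩
    rcases List.mem_cons.1 hg with rfl | hg
    exacts [hk.mono (le_max_right _ _), (hn g hg).mono (le_max_left _ _)]

/-- Conservation of rarity under products with the uniform distribution. -/
theorem exists_rarity_tensor_le {m : List Bool → ℝ} (hm : IsUniversalDistr m) {μ : Elem → ℝ}
    (hμ : IsSemimeasure μ) {U V : W → Elem → ℝ} (hU : IsGenerator μ U)
    (hV : IsUniversalGenerator m (prodS μ lam) V) :
    ∃ c : ℝ, ∀ (φ : Elem → ℝ) (E : Set Elem), IsSemimeasure φ → IsLattice E →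
      rarity m (tensor E) (prodS φ lam) V ≤ rarity m E φ U + (c : EReal) := by
  obtain ⟨C₁, hC₁, hVB⟩ := exists_nat_testOf_le hV (hU.sliceOp hμ)
  obtain ⟨C₂, hC₂, hm₂⟩ := exists_lintegral_testLam_pair_le hm
  have hUs := hU.operator.semimeasure
  have hC : 1 ≤ 2 * C₁ * C₂ := Nat.mul_pos (by omega) (by omega)
  refine ⟨_, fun φ E hφ hE => rarity_le_add m hC ?_⟩
  have hν := coarse_spec (tensor E) (isSemimeasure_prodS hφ)
  have hψ := coarse_spec E hφ
  rw [Nat.cast_mul, mul_assoc]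
  refine innerExt_testOf_le hν.eMeasure.semimeasure hC₁
    (hVB _ fun c _ f hf => (isLattice_tensor E).smul_mem c f hf)
    (zero_mem_testSet (isSemimeasure_sliceOp hUs) (isLattice_tensor E).zero_mem) fun l hl => ?_
  obtain ⟨n, hn⟩ := exists_common_modulus (emaxList l :: l)
  have hH := hn (emaxList l) (by simp)
  obtain ⟨h1, h2⟩ := le_lower_average hE hφ hν.eMeasure hν.le
    ((isLattice_tensor E).emaxList_mem fun f hf => (hl f hf).1) (emaxList_nonneg l) hH
  exact (ENNReal.ofReal_le_ofReal (h2.trans (hψ.lower_le hφ h1))).trans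
    (ofReal_le_innerExt_testOf hψ.eMeasure.semimeasure hC₂
      (average_le_testOf hE hUs hC₂ hm₂ hl (fun f hf => hn f (by simp [hf])) hH))

/-! ### Composition of operators -/

/-- The composition of operators: `ω ↦ A(U(ω))`. -/
noncomputable def compOp (U A : W → Elem → ℝ) (ω : W) (f : Elem) : ℝ := output A (U ω) f

theorem isSemimeasure_output {A : W → Elem → ℝ} (hA : ∀ ω, IsSemimeasure (A ω)) {φ : Elem → ℝ}
    (hφ : IsSemimeasure φ) : IsSemimeasure (output A φ) := isSemimeasure_inner hφ hA

section CompOp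

variable {U A : W → Elem → ℝ} (hU : ∀ ω, IsSemimeasure (U ω)) (hA : ∀ ω, IsSemimeasure (A ω))
include hU hA

theorem isSemimeasure_compOp (ω : W) : IsSemimeasure (compOp U A ω) :=
  isSemimeasure_inner (hU ω) hA

theorem isDeterministic_compOp (hUd : ∀ ω, IsDeterministic (U ω))
    (hAd : ∀ ω, IsDeterministic (A ω)) (ω : W) : IsDeterministic (compOp U A ω) := by
  intro f g
  have h := IsSemimeasure.exists_bound hA (emin f g)
  have h1 : ∀ ξ, A ξ (emin f g) = min (A ξ f) (A ξ g) := fun ξ => hAd ξ f g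
  change inner (U ω) (fun ξ => A ξ (emin f g)) = min (inner (U ω) _) (inner (U ω) _)
  simp only [h1] at h ⊢
  exact inner_min (hU ω) (hUd ω) (IsSemimeasure.exists_bound hA f)
    (IsSemimeasure.exists_bound hA g) h

/-- Bounds on a composition are witnessed by strict minorants of `A(f)`. -/
theorem lt_compOp_iff {f : Elem} (hf : 0 ≤ f) (ω : W) (q : ℚ) : (q : ℝ) < compOp U A ω f ↔
    ∃ h : Elem, 0 ≤ h ∧ (∀ ξ, h.1 ξ ≤ 0 ∨ (h.1 ξ : ℝ) < A ξ f) ∧ (q : ℝ) < U ω h := by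
  have hAf : IsBdd fun ξ => A ξ f := IsSemimeasure.exists_bound hA f
  constructor
  · intro hq
    obtain ⟨k, hk, hqk⟩ := exists_of_lt_inner (hU ω) hAf hq
    set h := emax k 0
    have h0 : 0 ≤ h := fun ξ => by
      change 0 ≤ (emax k 0).1 ξ
      rw [emax_apply]
      exact le_max_right _ _
    have hle : ∀ ξ, (h.1 ξ : ℝ) ≤ A ξ f := fun ξ => by
      simp only [h, emax_apply]
      push_cast
      exact max_le (hk ξ) (by simpa using (hA ξ).nonneg f hf)
    have hqh : (q : ℝ) < U ω h := hqk.trans_le ((hU ω).mono fun ξ => by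
      change k.1 ξ ≤ (emax k 0).1 ξ
      rw [emax_apply]
      exact le_max_left _ _)
    obtain ⟨c, hc0, hc1, hc⟩ : ∃ c : ℚ, 0 < c ∧ c < 1 ∧ (q : ℝ) < c * U ω h := by
      have hUh := (hU ω).nonneg h h0
      rcases lt_or_ge q 0 with hq0 | hq0
      · refine ⟨1 / 2, by norm_num, by norm_num, lt_of_lt_of_le (b := 0) (by exact_mod_cast hq0) ?_⟩
        exact mul_nonneg (by norm_num) hUh
      · have hq0' : (0 : ℝ) ≤ q := by exact_mod_cast hq0
        have hpos : 0 < U ω h := hq0'.trans_lt hqh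
        obtain ⟨c, hc1, hc2⟩ := exists_rat_btwn ((div_lt_one hpos).2 hqh)
        exact ⟨c, by exact_mod_cast (div_nonneg hq0' hpos.le).trans_lt hc1, by exact_mod_cast hc2,
          (div_lt_iff₀ hpos).1 hc1⟩
    refine ⟨c • h, smul_nonneg_elem hc0.le h0, fun ξ => ?_, by rwa [(hU ω).map_smul hc0]⟩
    rcases le_or_gt (h.1 ξ) 0 with h1 | h1
    · exact Or.inl (mul_nonpos_of_nonneg_of_nonpos hc0.le h1)
    · refine Or.inr (lt_of_lt_of_le ?_ (hle ξ))
      rw [Rat.cast_lt, smul_apply]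
      exact mul_lt_of_lt_one_left h1 hc1
  · rintro ⟨h, -, hle, hq⟩
    refine hq.trans_le (le_inner (hU ω) hAf fun ξ => ?_)
    rcases hle ξ with h1 | h1
    · exact le_trans (by exact_mod_cast h1) ((hA ξ).nonneg f hf)
    · exact h1.le

theorem isEnumerableOp_compOp (hUe : IsEnumerableOp U) (hAe : IsEnumerableOp A) :
    IsEnumerableOp (compOp U A) := by
  obtain ⟨S, hS, hSU⟩ := hUe
  obtain ⟨R, hR, hRA⟩ := hAe
  -- `b` is a code of a strict minorant of `A(f)` together with a depth at which this is seen
  refine ⟨fun a => ∃ b : ElemCode × ℕ, (∀ p ∈ b.1, p.1.length ≤ b.2) ∧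
    (∀ x ∈ strings b.2, RatCode.val (0, 0, 0) ≤ (b.1.eval x).val ∧
      ((b.1.eval x).val ≤ RatCode.val (0, 0, 0) ∨
        ∃ c : ℕ × RatCode, R (a.1, x.take c.1, c.2) ∧ (b.1.eval x).val ≤ c.2.val)) ∧
    S (b.1, a.2.1, a.2.2), ?_, ?_⟩
  · have e1 : Primrec fun a : List Bool × ((ElemCode × List Bool × RatCode) × (ElemCode × ℕ)) =>
        a.2.2.1.eval a.1 := primrec_elemCode_eval.comp
      (Primrec.fst.comp (Primrec.snd.comp Primrec.snd)) Primrec.fst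
    have e2 : Primrec fun a : (List Bool × ((ElemCode × List Bool × RatCode) × (ElemCode × ℕ))) ×
        (ℕ × RatCode) => (a.1.2.1.1, a.1.1.take a.2.1, a.2.2) :=
      Primrec.pair (Primrec.fst.comp (Primrec.fst.comp (Primrec.snd.comp Primrec.fst)))
        (Primrec.pair (Primrec.list_take.comp (Primrec.fst.comp Primrec.snd)
          (Primrec.fst.comp Primrec.fst)) (Primrec.snd.comp Primrec.snd))
    have e3 : Primrec fun a : (ElemCode × List Bool × RatCode) × (ElemCode × ℕ) =>
        (a.2.1, a.1.2.1, a.1.2.2) := Primrec.pair (Primrec.fst.comp Primrec.snd)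
      (Primrec.snd.comp Primrec.fst)
    have p1 := (REPred.of_primrec (primrec_ratCode_le.comp (Primrec.const (0, 0, 0)) e1)).and
      ((REPred.of_primrec (primrec_ratCode_le.comp e1 (Primrec.const (0, 0, 0)))).or
        ((hR.comp e2).and (REPred.of_primrec (primrec_ratCode_le.comp (e1.comp Primrec.fst)
          (Primrec.snd.comp Primrec.snd)))).exists)
    have p2 := p1.forall_mem (f := fun a : (ElemCode × List Bool × RatCode) × (ElemCode × ℕ) =>
      strings a.2.2) (primrec_strings.comp (Primrec.snd.comp Primrec.snd))
    have p3 : REPred fun a : (ElemCode × List Bool × RatCode) × (ElemCode × ℕ) =>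
        ∀ p ∈ a.2.1, p.1.length ≤ a.2.2 := REPred.of_primrec (primrec_bounded_lengths.comp
      (Primrec.fst.comp Primrec.snd) (Primrec.snd.comp Primrec.snd))
    exact (p3.and (p2.and (hS.comp e3))).exists
  · intro l hl q ω
    rw [lt_compOp_iff hU hA hl]
    constructor
    · rintro ⟨h, h0, hlt, hq⟩
      obtain ⟨l', rfl⟩ := ElemCode.exists_val_eq h
      obtain ⟨n, hn⟩ := exists_length_bound l'
      obtain ⟨s, hs⟩ := exists_finset_of_locally (P := fun (c : ℕ × RatCode) ξ =>
          l'.val.1 ξ ≤ 0 ∨ R (l, prefixOf ξ c.1, c.2) ∧ l'.val.1 ξ ≤ c.2.val) fun ξ => by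
        rcases hlt ξ with h1 | h1
        · exact ⟨(0, 0, 0, 0), n, fun ζ hζ => Or.inl (by rwa [ElemCode.hasModulus hn _ _ hζ])⟩
        · obtain ⟨r, hr1, hr2⟩ := exists_rat_btwn h1
          obtain ⟨r, rfl⟩ := RatCode.exists_val_eq r
          obtain ⟨j, hj⟩ := (hRA l hl r ξ).1 hr2
          refine ⟨(j, r), max n j, fun ζ hζ => Or.inr ⟨?_, ?_⟩⟩
          · rw [prefixOf_mono (le_max_right n j) hζ]
            exact hj
          · rw [ElemCode.hasModulus hn _ _ (prefixOf_mono (le_max_left n j) hζ)]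
            exact_mod_cast hr1.le
      rw [hSU _ h0] at hq
      obtain ⟨k, hk⟩ := hq
      set N := max n (s.sup Prod.fst)
      have hn' : ∀ p ∈ l', p.1.length ≤ N := fun p hp => (hn p hp).trans (le_max_left _ _)
      refine ⟨k, (l', N), hn', fun x hx => ?_, hk⟩
      have hx' : x.length = N := mem_strings.1 hx
      have hpx : prefixOf (pad x) N = x := by
        rw [← hx']
        exact prefixOf_pad x
      have hev : (l'.eval x).val = l'.val.1 (pad x) := by
        rw [ElemCode.val_apply hn', hpx]
      rw [RatCode.val_zero, hev]
      refine ⟨h0 _, ?_⟩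
      obtain ⟨c, hcs, hc⟩ := hs (pad x)
      refine hc.imp id fun ⟨h1, h2⟩ => ⟨c, ?_, h2⟩
      rwa [← hpx, take_prefixOf, min_eq_left
        ((Finset.le_sup (f := Prod.fst) hcs).trans (le_max_right _ _))]
    · rintro ⟨k, ⟨l', N⟩, hn, hx, hk⟩
      have hval : ∀ ξ, l'.val.1 ξ = (l'.eval (prefixOf ξ N)).val := ElemCode.val_apply hn
      have h0 : 0 ≤ l'.val := fun ξ => by
        have := (hx (prefixOf ξ N) (mem_strings.2 (by simp))).1
        rw [RatCode.val_zero, ← hval] at this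
        exact this
      refine ⟨l'.val, h0, fun ξ => ?_, (hSU _ h0 q ω).2 ⟨k, hk⟩⟩
      rcases (hx (prefixOf ξ N) (mem_strings.2 (by simp))).2 with h1 | ⟨c, h1, h2⟩
      · exact Or.inl (by rwa [hval, ← RatCode.val_zero])
      · rw [take_prefixOf] at h1
        refine Or.inr (lt_of_le_of_lt ?_ ((hRA l hl c.2 ξ).2 ⟨_, h1⟩))
        rw [hval]
        exact_mod_cast h2

theorem output_compOp_le {μ : Elem → ℝ} (hμ : IsSemimeasure μ) (hUe : IsEnumerableOp U)
    (hle : PosLE (output U lam) μ) : PosLE (output (compOp U A) lam) (output A μ) := by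
  intro f hf
  have hAf : IsBdd fun ξ => A ξ f := IsSemimeasure.exists_bound hA f
  refine inner_le isSemimeasure_lam
    (IsSemimeasure.exists_bound (isSemimeasure_compOp hU hA) f) fun k hk => ?_
  by_contra! hlt
  obtain ⟨ε, hε0, hε⟩ := exists_rat_btwn (sub_pos.2 hlt)
  have hε0' : 0 < ε := by exact_mod_cast hε0
  -- by compactness, finitely many minorants of `A(f)` give the values of `A(U(ω))(f)` up to `ε`
  obtain ⟨s, hs⟩ := exists_finset_of_locally
    (P := fun (h : {h : Elem // 0 ≤ h ∧ ∀ ξ, (h.1 ξ : ℝ) ≤ A ξ f}) ω =>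
      ((k.1 ω - ε : ℚ) : ℝ) < U ω h.1) fun ω => by
    have h1 : ((k.1 ω - ε : ℚ) : ℝ) < compOp U A ω f := by
      refine lt_of_lt_of_le ?_ (hk ω)
      rw [Rat.cast_lt]
      linarith
    obtain ⟨h, h0, hle, hq⟩ := (lt_compOp_iff hU hA hf ω _).1 h1
    have hle' : ∀ ξ, (h.1 ξ : ℝ) ≤ A ξ f := fun ξ => by
      rcases hle ξ with h2 | h2
      · exact le_trans (by exact_mod_cast h2) ((hA ξ).nonneg f hf)
      · exact h2.le
    obtain ⟨n, hn⟩ := (hUe.isSupOf hU h0).locally_lt hq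
    obtain ⟨n', hn'⟩ := exists_hasModulus k
    refine ⟨⟨h, h0, hle'⟩, max n n', fun ξ hξ => ?_⟩
    rw [hn' _ _ (prefixOf_mono (le_max_right _ _) hξ)]
    exact hn ξ (prefixOf_mono (le_max_left _ _) hξ)
  set H := emaxList (s.toList.map Subtype.val)
  have hHA : ∀ ξ, (H.1 ξ : ℝ) ≤ A ξ f := fun ξ => by
    rcases emaxList_apply_eq (s.toList.map Subtype.val) ξ with h1 | ⟨g, hg, h1⟩
    · rw [h1, Rat.cast_zero]
      exact (hA ξ).nonneg f hf
    · rw [h1]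
      obtain ⟨h, -, rfl⟩ := List.mem_map.1 hg
      exact h.2.2 ξ
  have h1 : lam (k + (-ε) • unity) ≤ output U lam H :=
    le_inner isSemimeasure_lam (IsSemimeasure.exists_bound hU H) fun ω => by
      obtain ⟨h, hh, h2⟩ := hs ω
      have h3 := (hU ω).mono (le_emaxList (List.mem_map_of_mem (f := Subtype.val)
        (Finset.mem_toList.2 hh)))
      refine le_trans (le_of_eq ?_) (h2.le.trans h3)
      simp [sub_eq_add_neg]
  rw [lam_add, lam_smul, lam_unity] at h1
  have h2 := hle H (emaxList_nonneg _)
  have h3 : μ H ≤ output A μ f := le_inner hμ hAf hHA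
  push_cast at h1
  linarith

theorem IsGenerator.compOp {μ : Elem → ℝ} (hμ : IsSemimeasure μ) (hUg : IsGenerator μ U)
    (hAd : ∀ ω, IsDeterministic (A ω)) (hAe : IsEnumerableOp A) :
    IsGenerator (output A μ) (compOp U A) where
  operator := ⟨isSemimeasure_compOp hU hA, fun _ hf =>
    (isEnumerableOp_compOp hU hA hUg.enum hAe).isSupOf (isSemimeasure_compOp hU hA) hf⟩
  deterministic := isDeterministic_compOp hU hA hUg.deterministic hAd
  enum := isEnumerableOp_compOp hU hA hUg.enum hAe
  le := output_compOp_le hU hA hμ hUg.enum hUg.le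

end CompOp

/-! ### Conservation under operators -/

theorem smul_mem_imageOf {A : W → Elem → ℝ} (hA : ∀ ω, IsSemimeasure (A ω)) {E : Set Elem}
    (hE : IsLattice E) {c : ℚ} (hc : 0 ≤ c) {f : Elem} (hf : f ∈ imageOf A E) :
    c • f ∈ imageOf A E := by
  refine ⟨smul_nonneg_elem hc hf.1, ?_⟩
  rcases hc.eq_or_lt with rfl | hc
  · refine ⟨{0}, by simpa using hE.zero_mem, fun ω => ?_⟩
    simp [(hA ω).map_zero]
  obtain ⟨S, hSE, hS⟩ := hf.2
  have hc' : (0 : ℝ) < c := by exact_mod_cast hc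
  refine ⟨(c • ·) '' S, ?_, fun ω => ?_⟩
  · rintro _ ⟨e, he, rfl⟩
    exact hE.smul_mem c e (hSE he)
  · beta_reduce
    rw [(hA ω).map_smul hc]
    constructor
    · rintro _ ⟨_, ⟨e, he, rfl⟩, rfl⟩
      simp only [smul_apply, Rat.cast_mul]
      exact mul_le_mul_of_nonneg_left ((hS ω).1 ⟨e, he, rfl⟩) hc'.le
    · intro r hr
      rw [← le_div_iff₀' hc']
      refine (hS ω).2 ?_
      rintro _ ⟨e, he, rfl⟩
      rw [le_div_iff₀' hc']
      simpa using hr ⟨_, ⟨e, he, rfl⟩, rfl⟩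

theorem zero_mem_imageOf {A : W → Elem → ℝ} (hA : ∀ ω, IsSemimeasure (A ω)) {E : Set Elem}
    (hE : IsLattice E) : (0 : Elem) ∈ imageOf A E :=
  ⟨le_rfl, {0}, by simpa using hE.zero_mem, fun ω => by simp [(hA ω).map_zero]⟩

/-- `A` takes the functions defining the test `t_{A(E)}` of the composition below the test
`t_E`. -/
theorem ofReal_le_testOf_of_mem_testSet {m : List Bool → ℝ} {U A : W → Elem → ℝ}
    (hU : ∀ ω, IsSemimeasure (U ω)) (hA : ∀ ω, IsSemimeasure (A ω)) {E : Set Elem}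
    (hE : IsLattice E) {f : Elem} (hf : f ∈ testSet m (compOp U A) (imageOf A E)) (ω : W) :
    ENNReal.ofReal (A ω f) ≤ testOf m U E ω := by
  obtain ⟨⟨hf0, S, hSE, hS⟩, -, hfT⟩ := hf
  by_cases ht : testOf m U E ω = ⊤
  · rw [ht]
    exact le_top
  rw [ENNReal.ofReal_le_iff_le_toReal ht]
  refine (hS ω).2 ?_
  rintro _ ⟨e, he, rfl⟩
  have h0 : 0 ≤ emax e 0 := fun ξ => by
    change 0 ≤ (emax e 0).1 ξ
    rw [emax_apply]
    exact le_max_right _ _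
  have h1 : emax e 0 ∈ testSet m U E := by
    refine ⟨hE.max_mem (hSE he) hE.zero_mem, h0, fun ξ => ?_⟩
    refine (ENNReal.ofReal_le_ofReal ?_).trans (hfT ξ)
    refine le_inner (hU ξ) (IsSemimeasure.exists_bound hA f) fun ζ => ?_
    rw [emax_apply]
    push_cast
    exact max_le ((hS ζ).1 ⟨e, he, rfl⟩) (by simpa using (hA ζ).nonneg f hf0)
  have h2 := (ENNReal.ofReal_le_iff_le_toReal ht).1 (le_testOf h1 ω)
  rw [emax_apply, Rat.cast_max] at h2
  exact (le_max_left _ _).trans h2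

theorem exists_le_mul_of_pos {f D : Elem} (hD : 0 ≤ D) :
    ∃ N : ℚ, 0 ≤ N ∧ ∀ ω, 0 < D.1 ω → f.1 ω ≤ N * D.1 ω := by
  obtain ⟨n, hn⟩ := exists_hasModulus D
  obtain ⟨c, hc0, hc⟩ := exists_bound f
  have h0 : ∀ x ∈ (strings n).toFinset, 0 ≤ c / D.1 (pad x) := fun x _ =>
    div_nonneg hc0.le (hD _)
  refine ⟨∑ x ∈ (strings n).toFinset, c / D.1 (pad x), Finset.sum_nonneg h0, fun ω hω => ?_⟩
  have h1 := Finset.single_le_sum h0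
    (List.mem_toFinset.2 (mem_strings.2 (by simp) : prefixOf ω n ∈ strings n))
  rw [hn.apply_pad, div_le_iff₀ hω] at h1
  exact ((abs_le.1 (hc ω)).2).trans h1

/-- The maximum of nonnegative functions of `hat E` is a sum of functions of `hat E` with disjoint
supports, each below one of the given functions. -/
theorem exists_disjoint_sum {E : Set Elem} (l : List Elem) (hl : ∀ f ∈ l, f ∈ hatPos E) :
    ∃ gs : List Elem, (∀ g ∈ gs, g ∈ hatPos E ∧ ∃ f ∈ l, g ≤ f) ∧
      gs.Pairwise (fun a b => ∀ ω, a.1 ω = 0 ∨ b.1 ω = 0) ∧ gs.sum = emaxList l := by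
  have hL : IsLattice (hat E) := isLattice_latticeSpan _
  induction l with
  | nil => exact ⟨[], by simp, by simp, rfl⟩
  | cons f l ih =>
    obtain ⟨gs, hgs, hdis, hsum⟩ := ih fun g hg => hl g (by simp [hg])
    have hf := hl f (by simp)
    set F := emaxList l
    have hF : F ∈ hat E := hL.emaxList_mem fun g hg => (hl g (by simp [hg])).1
    -- multiples of `D = max (f - F) 0` cut functions down to the set where `f > F`
    set D := emax (f - F) 0
    have hDapp : ∀ ω, D.1 ω = max (f.1 ω - F.1 ω) 0 := fun ω => by simp [D]
    have hD0 : 0 ≤ D := fun ω => by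
      change 0 ≤ D.1 ω
      rw [hDapp]
      exact le_max_right _ _
    have hDE : D ∈ hatPos E := ⟨hL.max_mem (hL.sub_mem hf.1 hF) hL.zero_mem, hD0⟩
    obtain ⟨N, hN0, hN⟩ := exists_le_mul_of_pos (f := f) hD0
    have hND := hatPos_smul hN0 hDE
    have cut1 : ∀ u : Elem, 0 ≤ u → ∀ ω, f.1 ω ≤ F.1 ω → (emin u (N • D)).1 ω = 0 := by
      intro u hu ω h
      have h1 : D.1 ω = 0 := by rw [hDapp, max_eq_right (by linarith)]
      simp only [emin_apply, smul_apply, h1, mul_zero]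
      exact min_eq_right (hu ω)
    have cut2 : ∀ u : Elem, ∀ ω, F.1 ω < f.1 ω → u.1 ω ≤ f.1 ω →
        (emin u (N • D)).1 ω = u.1 ω := by
      intro u ω h h1
      have h2 : 0 < D.1 ω := by
        rw [hDapp]
        exact lt_max_of_lt_left (by linarith)
      exact min_eq_left (h1.trans (hN ω h2))
    have hgF : ∀ g ∈ gs, g ≤ F := fun g hg => hsum ▸ le_list_sum (fun k hk => (hgs k hk).1) hg
    refine ⟨emin f (N • D) :: gs.map fun g => g - emin g (N • D), ?_, ?_, ?_⟩
    · intro g hg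
      rcases List.mem_cons.1 hg with rfl | hg
      · exact ⟨hatPos_emin hf hND, f, by simp, emin_le_left _ _⟩
      · obtain ⟨k, hk, rfl⟩ := List.mem_map.1 hg
        obtain ⟨h1, f', hf', h2⟩ := hgs k hk
        have h3 := hatPos_emin h1 hND
        refine ⟨hatPos_sub h1 h3 (emin_le_left _ _), f', by simp [hf'], fun ω => ?_⟩
        exact (sub_le_self _ (h3.2 ω)).trans (h2 ω)
    · refine List.pairwise_cons.2 ⟨fun g hg ω => ?_, ?_⟩
      · obtain ⟨k, hk, rfl⟩ := List.mem_map.1 hg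
        rcases le_or_gt (f.1 ω) (F.1 ω) with h | h
        · exact Or.inl (cut1 f hf.2 ω h)
        · refine Or.inr ?_
          rw [sub_apply, cut2 k ω h ((hgF k hk ω).trans h.le), sub_self]
      · rw [List.pairwise_map]
        refine hdis.imp_of_mem fun {a b} ha hb hab ω => ?_
        have key : ∀ g ∈ gs, g.1 ω = 0 → (g - emin g (N • D)).1 ω = 0 := fun g hg h0 => by
          have h1 : 0 ≤ (N • D).1 ω := hND.2 ω
          rw [sub_apply, emin_apply, h0, min_eq_left h1, sub_zero]
        exact (hab ω).imp (key a ha) (key b hb)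
    · refine elem_ext fun ω => ?_
      have h1 : (emaxList (f :: l)).1 ω = max (f.1 ω) (F.1 ω) := emax_apply _ _ _
      have h2 : F.1 ω = (gs.map fun g : Elem => g.1 ω).sum := by rw [← hsum, list_sum_apply]
      rw [h1, List.sum_cons, add_apply, list_sum_apply, List.map_map]
      rcases le_or_gt (f.1 ω) (F.1 ω) with h | h
      · rw [cut1 f hf.2 ω h, max_eq_right h, zero_add, h2]
        congr 1
        refine List.map_congr_left fun g hg => ?_
        simp only [Function.comp_apply]
        rw [sub_apply, cut1 g (hgs g hg).1.2 ω h, sub_zero]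
      · rw [cut2 f ω h le_rfl, max_eq_left h.le]
        have h3 : (gs.map ((fun g : Elem => g.1 ω) ∘ fun g => g - emin g (N • D))) =
            gs.map fun _ => 0 := List.map_congr_left fun g hg => by
          simp only [Function.comp_apply]
          rw [sub_apply, cut2 g ω h ((hgF g hg ω).trans h.le), sub_self]
        rw [h3]
        simp

theorem list_sum_eq_of_pairwise {X : Type*} (a : X → ℝ) (l : List X)
    (h : l.Pairwise fun x y => a x = 0 ∨ a y = 0) :
    (l.map a).sum = 0 ∨ ∃ x ∈ l, (l.map a).sum = a x := by
  induction l with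
  | nil => exact Or.inl rfl
  | cons x l ih =>
    obtain ⟨h1, h2⟩ := List.pairwise_cons.1 h
    rw [List.map_cons, List.sum_cons]
    by_cases hx : a x = 0
    · rw [hx, zero_add]
      exact (ih h2).imp id fun ⟨y, hy, h3⟩ => ⟨y, by simp [hy], h3⟩
    · refine Or.inr ⟨x, by simp, ?_⟩
      have h3 : (l.map a).sum = 0 := List.sum_eq_zero fun r hr => by
        obtain ⟨y, hy, rfl⟩ := List.mem_map.1 hr
        exact (h1 y hy).resolve_left hx
      rw [h3, add_zero]

/-- A semimeasure is superadditive on finite sums of bounded functions. -/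
theorem sum_inner_le {φ : Elem → ℝ} (hφ : IsSemimeasure φ) {A : W → Elem → ℝ}
    (hA : ∀ ω, IsSemimeasure (A ω)) (l : List Elem) :
    IsBdd (fun ω => (l.map (A ω)).sum) ∧
      (l.map (output A φ)).sum ≤ inner φ fun ω => (l.map (A ω)).sum := by
  induction l with
  | nil =>
    refine ⟨⟨0, by simp⟩, ?_⟩
    have := inner_elem hφ 0
    simp only [zero_apply, Rat.cast_zero, hφ.map_zero] at this
    simp [this]
  | cons f l ih =>
    obtain ⟨⟨c, hc⟩, h2⟩ := ih
    obtain ⟨d, hd⟩ := IsSemimeasure.exists_bound hA f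
    have hb : IsBdd (fun ω => ((f :: l).map (A ω)).sum) := by
      refine ⟨d + c, fun ω => ?_⟩
      simp only [List.map_cons, List.sum_cons]
      push_cast
      exact (abs_add_le _ _).trans (add_le_add (hd ω) (hc ω))
    refine ⟨hb, ?_⟩
    have h3 := inner_concave hφ (c := 1) ⟨d, hd⟩ ⟨c, hc⟩ hb zero_le_one fun ω => by simp
    rw [Rat.cast_one, one_mul] at h3
    simp only [List.map_cons, List.sum_cons] at h3 ⊢
    exact le_trans (add_le_add le_rfl h2) h3

/-- On functions with disjoint supports a deterministic semimeasure takes at most one nonzero value,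
so the sum of the values is bounded by any common bound of them. -/
theorem sum_le_testOf {m : List Bool → ℝ} {A U : W → Elem → ℝ} {E : Set Elem}
    (hA : ∀ ω, IsSemimeasure (A ω)) (hAd : ∀ ω, IsDeterministic (A ω)) {gs : List Elem}
    (h0 : ∀ g ∈ gs, 0 ≤ g) (hdis : gs.Pairwise fun a b => ∀ ω, a.1 ω = 0 ∨ b.1 ω = 0)
    (hle : ∀ g ∈ gs, ∀ ω, ENNReal.ofReal (A ω g) ≤ testOf m U E ω) (ω : W) :
    ENNReal.ofReal (gs.map (A ω)).sum ≤ testOf m U E ω := by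
  have h : gs.Pairwise fun a b => A ω a = 0 ∨ A ω b = 0 := by
    refine hdis.imp_of_mem fun {a b} ha hb hab => ?_
    have h1 : emin a b = 0 := elem_ext fun ξ => by
      have h2 : 0 ≤ a.1 ξ := h0 a ha ξ
      have h3 : 0 ≤ b.1 ξ := h0 b hb ξ
      rw [emin_apply, zero_apply]
      rcases hab ξ with h4 | h4 <;> rw [h4]
      exacts [min_eq_left h3, min_eq_right h2]
    have h2 := hAd ω a b
    rw [h1, (hA ω).map_zero] at h2
    rcases min_choice (A ω a) (A ω b) with h3 | h3
    exacts [Or.inl (h3.symm.trans h2.symm), Or.inr (h3.symm.trans h2.symm)]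
  rcases list_sum_eq_of_pairwise (A ω) gs h with h1 | ⟨g, hg, h1⟩
  · rw [h1, ENNReal.ofReal_zero]
    exact zero_le
  · rw [h1]
    exact hle g hg ω

theorem ofReal_inner_le {φ : Elem → ℝ} (hφ : IsSemimeasure φ) {g : W → ℝ} (hg : IsBdd g)
    {t : W → ENNReal} (h : ∀ ω, ENNReal.ofReal (g ω) ≤ t ω) :
    ENNReal.ofReal (inner φ g) ≤ (innerExt φ fun ω => (t ω : EReal)).toENNReal := by
  have h1 : (inner φ g : EReal) ≤ innerExt φ fun ω => (t ω : EReal) := by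
    rw [← innerExt_eq_coe hφ hg]
    refine iSup₂_le fun k hk => le_innerExt φ fun ω => (hk ω).trans ?_
    refine le_trans ?_ (EReal.coe_ennreal_le_coe_ennreal_iff.2 (h ω))
    rw [EReal.coe_ennreal_ofReal, EReal.coe_le_coe_iff]
    exact le_max_left _ _
  have h2 := EReal.toENNReal_le_toENNReal h1
  rwa [EReal.toENNReal_of_ne_top (EReal.coe_ne_top _), EReal.toReal_coe] at h2

/-- The mean of `t_E` is the same, up to a factor, for all choices of `φ_E`. -/
theorem innerExt_testOf_le_meanTest {m : List Bool → ℝ} {E : Set Elem} (hE : IsLattice E)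
    {φ ψ : Elem → ℝ} (hφ : IsSemimeasure φ) (hψ : IsCoarse E φ ψ) {U : W → Elem → ℝ}
    (hU : ∀ ω, IsSemimeasure (U ω)) :
    (innerExt ψ fun ω => (testOf m U E ω : EReal)).toENNReal ≤ 2 * meanTest m E φ U := by
  have hc := coarse_spec E hφ
  have h := innerExt_testOf_le (m := m) (E := E) (V := U) (B := U) hψ.eMeasure.semimeasure
    (C := 1) le_rfl (fun ω => by simp) (zero_mem_testSet hU hE.zero_mem)
    (r := meanTest m E φ U) fun l hl => by
      have h1 : emaxList l ∈ E := hE.emaxList_mem fun f hf => (hl f hf).1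
      have h2 := hc.largest ψ hψ.eMeasure hψ.le _ (subset_hat E h1) (emaxList_nonneg l)
      refine (ENNReal.ofReal_le_ofReal h2).trans ?_
      rw [← inner_elem hc.eMeasure.semimeasure (emaxList l)]
      refine ofReal_inner_le hc.eMeasure.semimeasure (IsBdd.elem _) fun ω => ?_
      rcases emaxList_apply_eq l ω with h3 | ⟨f, hf, h3⟩
      · rw [h3]
        simp
      · rw [h3]
        exact le_testOf (hl f hf) ω
  simpa using h

/-- Conservation of rarity under deterministic operators. -/
theorem exists_rarity_imageOf_le {m : List Bool → ℝ} {μ : Elem → ℝ}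
    (hμ : IsSemimeasure μ) {U V A : W → Elem → ℝ} (hU : IsGenerator μ U)
    (hA : ∀ ω, IsSemimeasure (A ω)) (hAd : ∀ ω, IsDeterministic (A ω)) (hAe : IsEnumerableOp A)
    (hV : IsUniversalGenerator m (output A μ) V) :
    ∃ c : ℝ, ∀ (φ : Elem → ℝ) (E : Set Elem), IsSemimeasure φ → IsLattice E →
      ∀ ψ : Elem → ℝ, IsCoarse E φ ψ →
        rarity m (imageOf A E) (output A ψ) V ≤ rarity m E φ U + (c : EReal) := by
  have hUs := hU.operator.semimeasure
  obtain ⟨C, hC, hVB⟩ := exists_nat_testOf_le hV (hU.compOp hUs hA hμ hAd hAe)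
  refine ⟨_, fun φ E hφ hE ψ hψ => rarity_le_add m (C := 2 * C * 2) (by omega) ?_⟩
  have hψs := hψ.eMeasure.semimeasure
  have hν := coarse_spec (imageOf A E) (isSemimeasure_output hA hψs)
  rw [Nat.cast_mul, mul_assoc]
  refine innerExt_testOf_le hν.eMeasure.semimeasure hC
    (hVB _ fun c hc f hf => smul_mem_imageOf hA hE hc hf)
    (zero_mem_testSet (isSemimeasure_compOp hUs hA) (zero_mem_imageOf hA hE)) fun l hl => ?_
  refine le_trans ?_ (innerExt_testOf_le_meanTest hE hφ hψ hUs)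
  obtain ⟨gs, hgs, hdis, hsum⟩ := exists_disjoint_sum (E := imageOf A E) l fun f hf =>
    ⟨subset_hat _ (hl f hf).1, (hl f hf).2.1⟩
  obtain ⟨hb, hs⟩ := sum_inner_le hψs hA gs
  have h1 : coarse (imageOf A E) (output A ψ) (emaxList l) ≤
      inner ψ fun ω => (gs.map (A ω)).sum := by
    rw [← hsum, (hν.eMeasure.map_list_sum fun g hg => (hgs g hg).1.1).2]
    exact (List.sum_le_sum fun g hg => hν.le g (hgs g hg).1.2).trans hs
  refine (ENNReal.ofReal_le_ofReal h1).trans (ofReal_inner_le hψs hb fun ω => ?_)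
  refine sum_le_testOf hA hAd (fun g hg => (hgs g hg).1.2) hdis (fun g hg ξ => ?_) ω
  obtain ⟨-, f, hf, hgf⟩ := hgs g hg
  exact (ENNReal.ofReal_le_ofReal ((hA ξ).mono hgf)).trans
    (ofReal_le_testOf_of_mem_testSet hUs hA hE (hl f hf) ξ)

end Rarity

theorem theorem1 (m : List Bool → ℝ) (hm : IsUniversalDistr m)
    (μ : Elem → ℝ) (hμ : IsSemimeasure μ) (hμe : IsEnumerable μ)
    (U : W → Elem → ℝ) (hU : IsUniversalGenerator m μ U) :
    (∀ V : W → Elem → ℝ, IsUniversalGenerator m (prodS μ lam) V →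
      ∃ c : ℝ, ∀ (φ : Elem → ℝ) (E : Set Elem), IsSemimeasure φ → IsLattice E →
        rarity m (tensor E) (prodS φ lam) V ≤ rarity m E φ U + (c : EReal)) ∧
    (∀ A : W → Elem → ℝ, IsOperator A → (∀ ω, IsDeterministic (A ω)) → IsEnumerableOp A →
      ∀ V : W → Elem → ℝ, IsUniversalGenerator m (output A μ) V →
      ∃ c : ℝ, ∀ (φ : Elem → ℝ) (E : Set Elem), IsSemimeasure φ → IsLattice E →
        ∀ ψ : Elem → ℝ, IsCoarse E φ ψ →
          rarity m (imageOf A E) (output A ψ) V ≤ rarity m E φ U + (c : EReal)) := by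
  have hUg := hU.1
  exact ⟨fun V hV => exists_rarity_tensor_le hm hμ hUg hV, fun A hA hAd hAe V hV =>
    exists_rarity_imageOf_le hμ hUg hA.semimeasure hAd hAe hV⟩
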